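/- **Theorem 2.2** (Magidority and elementary embeddings). Let $\lambda$ be a cardinal with $\lambda>\mathrm{cf}(\lambda)=\omega$. Write $[X]^{\aleph_0}$ for the set of subsets of $X$ of cardinality $\aleph_0$, and, for $A\subseteq\lambda$, $[A]^{\aleph_0\text{-bd}}$ for the set of those $u\in[A]^{\aleph_0}$ that are bounded in $\lambda$. Call $\lambda$ a *Magidor cardinal* if for every function $c:[\lambda]^{\aleph_0\text{-bd}}\to\lambda$ there are a set $A\subseteq\lambda$ with $|A|=\lambda$ and an ordinal $\eta<\lambda$ such that $c(u)\neq\eta$ for every $u\in[A]^{\aleph_0\text{-bd}}$. Then the following are equivalent: (a) $\lambda$ is a Magidor cardinal. (b) For every ordinal $\gamma>\lambda$ there is a triple $(M,(M_n)_{n\in\omega},j)$ such that - $M$ is a transitive set with $\lambda+1\subseteq M$; - $j:(M,\in)\to(V_\gamma,\in)$ is an elementary embedding with $\mathrm{crit}(j)<\lambda=j(\lambda)$, where $\mathrm{crit}(j)$ is the least ordinal $\beta\in M$ with $j(\beta)>\beta$; - $M=\bigcup_{n\in\omega}M_n$, where $M_n\prec M$ and $M_n\subseteq M_{n+1}$ for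 every $n\in\omega$; - for every $\delta<\lambda$ there is $n_\delta\in\omega$ such that $[M_n\cap\delta]^{\aleph_0}\subseteq M$ for every $n\geq n_\delta$; - $\lambda\not\subseteq j''M$. (c) For some ordinal $\gamma>\lambda$ there is a triple $(M,(M_n)_{n\in\omega},j)$ with the properties listed in (b). -/

import Mathlib

open scoped FirstOrder

universe u

/-- The relation symbols of the language of set theory: a single binary one. -/
inductive SetTheoryRel : ℕ → Type
  | mem : SetTheoryRel 2

/-- The first-order language `{∈}` of set theory. -/
def setTheory : FirstOrder.Language where
  Functions := fun _ => Empty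
  Relations := SetTheoryRel

/-- Every set `M` is regarded as the `{∈}`-structure `(M, ∈)`. -/
instance setTheoryStructure (M : ZFSet.{u}) : setTheory.Structure M where
  funMap := fun f => f.elim
  RelMap := fun r v => match r with
    | SetTheoryRel.mem => (v 0 : ZFSet.{u}) ∈ (v 1 : ZFSet.{u})

/-- `[lam]^{ℵ₀-bd}`: the subsets of the cardinal `lam` (viewed as the set of ordinals below it)
which have cardinality `ℵ₀` and are bounded in `lam`. -/
def boundedCountable (lam : Cardinal.{u}) : Set (Set Ordinal.{u}) :=
  {w | Cardinal.mk w = Cardinal.aleph0 ∧ ∃ δ < lam.ord, w ⊆ Set.Iio δ}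

/-- `lam` is a Magidor cardinal, `lam → [lam]^{ℵ₀-bd}_lam`: for every coloring of
`[lam]^{ℵ₀-bd}` by `lam` colors there is `A ⊆ lam` of cardinality `lam` such that
the coloring omits some color on `[A]^{ℵ₀-bd}`. -/
def IsMagidor (lam : Cardinal.{u}) : Prop :=
  ∀ c : boundedCountable lam → Set.Iio lam.ord,
    ∃ A : Set Ordinal.{u}, A ⊆ Set.Iio lam.ord ∧ Cardinal.mk A = Cardinal.lift.{u + 1} lam ∧
      ∃ η : Set.Iio lam.ord, ∀ w : boundedCountable lam, (w : Set Ordinal.{u}) ⊆ A → c w ≠ η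

/-- `κ = crit(j)`: the least ordinal `β ∈ M` with `β < j(β)`. -/
def IsCriticalPoint {M N : ZFSet.{u}} (j : M ↪ₑ[setTheory] N) (κ : Ordinal.{u}) : Prop :=
  IsLeast {β : Ordinal.{u} | ∃ h : β.toZFSet ∈ M, β.toZFSet ∈ (j ⟨β.toZFSet, h⟩ : ZFSet.{u})} κ

/-- The properties required of a triple `(M, (Mₙ)ₙ, j)`, where `M` is a set,
`Mₙ ≺ M` for all `n`, and `j : M → V_γ` is elementary. -/
structure IsMagidorTriple (lam : Cardinal.{u}) (γ : Ordinal.{u}) (M : ZFSet.{u})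
    (Mseq : ℕ → setTheory.ElementarySubstructure M)
    (j : M ↪ₑ[setTheory] (ZFSet.vonNeumann γ)) : Prop where
  transitive : M.IsTransitive
  succ_subset : (lam.ord + 1).toZFSet ⊆ M
  crit_lt : ∃ κ < lam.ord, IsCriticalPoint j κ
  map_eq : ∃ h : lam.ord.toZFSet ∈ M, (j ⟨lam.ord.toZFSet, h⟩ : ZFSet.{u}) = lam.ord.toZFSet
  monotone : Monotone Mseq
  union : ∀ x : M, ∃ n, x ∈ Mseq n
  /-- For every `δ < lam`, `[Mₙ ∩ δ]^{ℵ₀} ⊆ M` for all large `n`. -/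
  countable_subsets : ∀ δ < lam.ord, ∃ n₀ : ℕ, ∀ n ≥ n₀, ∀ v : ZFSet.{u},
    v.card = Cardinal.aleph0 → v ⊆ δ.toZFSet →
      (∀ x ∈ v, ∃ y ∈ Mseq n, (y : ZFSet.{u}) = x) → v ∈ M
  /-- `lam ⊄ j''M`. -/
  not_subset : ¬ ∀ x ∈ lam.ord.toZFSet, ∃ y : M, (j y : ZFSet.{u}) = x

/-! (c) → (a). If λ is not Magidor, some coloring refutes it, and a set C in M codes such a
coloring, with j(C) doing the same in V_γ (`exists_counterexampleIn` and elementarity). Fix η < λ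
outside the range of j. Since cf(λ) = ω, there is A ⊆ λ of size λ each of whose bounded parts lies
in some Mₙ with n as large as required (`exists_mk_eq_inter_subset`). Some countable bounded w ⊆
j''A gets color η under j(C). All countable subsets of its preimage v ⊆ A belong to M, so j(v) =
j''v = w (`map_eq_image_of_countable`). Hence η = j(C)(j(v)) = j(C(v)) is in the range of j, a
contradiction.

(a) → (b). Close sets of ordinals inside V_γ under Skolem functions and under forming countable sets
that belong to V_γ. The hull of a countable set v has at most continuum many elements, so reals
enumerate it. A coloring G of sets of ordinals by reals takes every value on the countably infinite
subsets of any infinite set (`exists_universal_coloring`). Color a countable set u by splitting it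
into its first ω elements w and the rest v: its color is the element of the hull of v with index
G(w). Let A omit the color η, and let A' be A without its first ω elements. If η were in the hull of
a bounded part of A', it would be in the hull of a countable v inside that part, with some index r;
a suitable w among the first ω elements of A has G(w) = r, so w ∪ v has color η. So the union of the
hulls of the bounded parts of A' omits η but contains λ many ordinals below λ. Its inverse Mostowski
collapse is j (`exists_magidorTriple`). -/

/-! ### Colorings by reals that are onto on every infinite set. -/

open Cardinal in
/-- A family of at most `κ` many sets, each of size at least `κ`, has distinct representatives. -/
theorem exists_injective_forall_mem {ι β : Type u} (P : ι → Set β)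
    (hP : ∀ i, #ι ≤ #(P i)) : ∃ f : ι → β, Function.Injective f ∧ ∀ i, f i ∈ P i := by
  obtain ⟨r, hr, hord⟩ := Cardinal.exists_ord_eq ι
  -- Recursion along a well-order of type `(#ι).ord`: fewer than `#ι` values are used before stage
  -- `i`, so they cannot exhaust `P i`.
  have key : ∀ i (ih : ∀ j, r j i → β), ∃ b ∈ P i, ∀ j hj, ih j hj ≠ b := by
    intro i ih
    by_contra! hcon
    have h1 : P i ⊆ Set.range fun j : {j // r j i} => ih j.1 j.2 := by
      intro b hb
      obtain ⟨j, hj, rfl⟩ := hcon b hb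
      exact ⟨⟨j, hj⟩, rfl⟩
    have h2 : #(P i) ≤ #{j // r j i} := (mk_le_mk_of_subset h1).trans mk_range_le
    have h3 : #{j // r j i} < #ι := Cardinal.card_typein_lt i hord
    exact ((hP i).trans h2).not_gt h3
  choose g hg1 hg2 using key
  let f : ι → β := hr.wf.fix g
  have hf : ∀ i, f i = g i fun j _ => f j := fun i => hr.wf.fix_eq g i
  have hne : ∀ i j, r j i → f j ≠ f i := fun i j hj => by
    rw [hf i]
    exact hg2 i (fun j _ => f j) j hj
  refine ⟨f, fun i j hij => ?_, fun i => hf i ▸ hg1 i _⟩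
  rcases trichotomous_of r i j with h | h | h
  · exact (hne _ _ h hij).elim
  · exact h
  · exact (hne _ _ h hij.symm).elim

open Cardinal in
theorem continuum_le_mk_infinite_subsets {α : Type u} {Y : Set α} (hY : Y.Infinite) :
    continuum.{u} ≤ #{w : Set α | w ⊆ Y ∧ w.Infinite} := by
  let g := Set.Infinite.natEmbedding Y hY
  -- The even-indexed points keep the set infinite; the odd-indexed ones code `r`.
  let F : Set ℕ → Set α := fun r =>
    Set.range (fun k : ℕ => (g (2 * k) : α)) ∪ (fun k : ℕ => (g (2 * k + 1) : α)) '' r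
  have hinj : ∀ a b : ℕ, (g a : α) = g b → a = b := fun a b h => g.injective (Subtype.ext h)
  have hF : Function.Injective F := by
    have hmem : ∀ r k, (g (2 * k + 1) : α) ∈ F r ↔ k ∈ r := by
      intro r k
      constructor
      · rintro (⟨l, hl⟩ | ⟨l, hl, h⟩)
        · have := hinj _ _ hl
          omega
        · have := hinj _ _ h
          obtain rfl : l = k := by omega
          exact hl
      · exact fun h => Or.inr ⟨k, h, rfl⟩
    intro r s h
    ext k
    rw [← hmem, ← hmem, h]
  have hF' : ∀ r, F r ⊆ Y ∧ (F r).Infinite := by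
    refine fun r => ⟨?_, ?_⟩
    · rintro _ (⟨k, rfl⟩ | ⟨k, -, rfl⟩) <;> exact (g _).2
    · refine (Set.infinite_range_of_injective fun a b h => ?_).mono Set.subset_union_left
      have := hinj _ _ h
      omega
  have := mk_le_of_injective (f := fun r : ULift.{u} (Set ℕ) =>
    (⟨F r.down, hF' _⟩ : {w : Set α | w ⊆ Y ∧ w.Infinite}))
    fun r s h => ULift.ext _ _ (hF (congrArg Subtype.val h))
  rw [mk_uLift, mk_set, mk_nat, two_power_aleph0, lift_continuum] at this
  exact this

open Cardinal in
theorem mk_subsets_le_continuum {α : Type u} {F : Set α} (hF : F.Countable) (p : Set α → Prop) :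
    #{Y : Set α // Y ⊆ F ∧ p Y} ≤ continuum.{u} := by
  have h : #{Y : Set α // Y ⊆ F ∧ p Y} ≤ #(Set F) := by
    refine mk_le_of_injective (f := fun Y => Subtype.val ⁻¹' Y.1) fun Y Z h => Subtype.ext ?_
    have := congrArg (Set.image Subtype.val) h
    simpa [Subtype.image_preimage_coe, Set.inter_eq_right.2 Y.2.1,
      Set.inter_eq_right.2 Z.2.1] using this
  refine h.trans ?_
  rw [mk_set, ← two_power_aleph0]
  exact power_le_power_left two_ne_zero (le_aleph0_iff_set_countable.2 hF)

open Cardinal in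
/-- On the subsets of a countable set there is a coloring by reals which takes every value on the
infinite subsets of every infinite set. -/
theorem exists_coloring_of_countable {α : Type u} {F : Set α} (hF : F.Countable) :
    ∃ G : Set α → Set ℕ, ∀ Y ⊆ F, Y.Infinite → ∀ r, ∃ w ⊆ Y, w.Infinite ∧ G w = r := by
  classical
  -- Each pair of an infinite `Y ⊆ F` and a real is a request. There are at most continuum many,
  -- each with at least continuum many candidates `w ⊆ Y`; distinct representatives let `w`
  -- determine its request.
  let ι : Type u := {Y : Set α // Y ⊆ F ∧ Y.Infinite} × Set ℕ
  have hι : #ι ≤ continuum.{u} := by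
    have : #(Set ℕ) = continuum.{0} := by simp
    simp only [ι, mk_prod, lift_uzero, this, lift_continuum]
    exact (mul_le_mul' (mk_subsets_le_continuum hF _) le_rfl).trans (by simp)
  obtain ⟨f, hf, hfP⟩ := exists_injective_forall_mem
    (fun i : ι => {w : Set α | w ⊆ i.1.1 ∧ w.Infinite})
    fun i => hι.trans (continuum_le_mk_infinite_subsets i.1.2.2)
  refine ⟨fun w => if h : ∃ i, f i = w then h.choose.2 else ∅, fun Y hYF hY r => ?_⟩
  let i : ι := (⟨Y, hYF, hY⟩, r)
  refine ⟨f i, (hfP i).1, (hfP i).2, ?_⟩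
  have h : ∃ k, f k = f i := ⟨i, rfl⟩
  change (if h : ∃ k, f k = f i then h.choose.2 else ∅) = r
  rw [dif_pos h, hf h.choose_spec]

/-- There is a coloring by reals of the subsets of `α` which takes every value on the countably
infinite subsets of every infinite set. -/
theorem exists_universal_coloring (α : Type u) :
    ∃ G : Set α → Set ℕ, ∀ X : Set α, X.Infinite → ∀ r,
      ∃ w ⊆ X, w.Infinite ∧ w.Countable ∧ G w = r := by
  classical
  -- A maximal almost disjoint family reduces to the countable case: every infinite set meets a
  -- member in an infinite set, and an infinite `w` lies in at most one member, which then
  -- determines its color.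
  let AD : Set (Set (Set α)) := {𝓕 | (∀ F ∈ 𝓕, F.Countable ∧ F.Infinite) ∧
    ∀ F ∈ 𝓕, ∀ F' ∈ 𝓕, F ≠ F' → (F ∩ F').Finite}
  obtain ⟨𝓕, h𝓕⟩ : ∃ 𝓕, Maximal (· ∈ AD) 𝓕 := by
    refine zorn_subset AD fun C hC hchain => ⟨⋃₀ C, ⟨?_, ?_⟩, fun s => Set.subset_sUnion_of_mem⟩
    · rintro F ⟨𝓖, h𝓖, hF⟩
      exact (hC h𝓖).1 F hF
    · rintro F ⟨𝓖, h𝓖, hF⟩ F' ⟨𝓖', h𝓖', hF'⟩ hne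
      rcases hchain.total h𝓖 h𝓖' with h | h
      · exact (hC h𝓖').2 F (h hF) F' hF' hne
      · exact (hC h𝓖).2 F hF F' (h hF') hne
  have hmeet : ∀ X : Set α, X.Infinite → ∃ F ∈ 𝓕, (F ∩ X).Infinite := by
    intro X hX
    by_contra! hcon
    let Y : Set α := Set.range fun n => (Set.Infinite.natEmbedding X hX n : α)
    have hYX : Y ⊆ X := by
      rintro _ ⟨n, rfl⟩
      exact (Set.Infinite.natEmbedding X hX n).2
    have hY : Y.Infinite := Set.infinite_range_of_injective
      (Subtype.val_injective.comp (Set.Infinite.natEmbedding X hX).injective)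
    have hfin : ∀ F ∈ 𝓕, (F ∩ Y).Finite := fun F hF =>
      (hcon F hF).subset (Set.inter_subset_inter_right F hYX)
    have hAD : insert Y 𝓕 ∈ AD := by
      refine ⟨?_, ?_⟩
      · rintro F (rfl | hF)
        · exact ⟨Set.countable_range _, hY⟩
        · exact h𝓕.prop.1 F hF
      · rintro F (rfl | hF) F' (rfl | hF') hne
        · exact (hne rfl).elim
        · rw [Set.inter_comm]
          exact hfin F' hF'
        · exact hfin F hF
        · exact h𝓕.prop.2 F hF F' hF' hne
    have hmem : Y ∈ 𝓕 := h𝓕.le_of_ge hAD (Set.subset_insert _ _) (Set.mem_insert _ _)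
    exact hY (by simpa using hfin Y hmem)
  have hex : ∀ F : 𝓕, ∃ G : Set α → Set ℕ, ∀ Y ⊆ F.1, Y.Infinite → ∀ r,
      ∃ w ⊆ Y, w.Infinite ∧ G w = r := fun F => exists_coloring_of_countable (h𝓕.prop.1 F F.2).1
  choose G hG using hex
  refine ⟨fun w => if h : ∃ F : 𝓕, w ⊆ F.1 then G h.choose w else ∅, fun X hX r => ?_⟩
  obtain ⟨F, hF, hFX⟩ := hmeet X hX
  obtain ⟨w, hw, hwi, rfl⟩ := hG ⟨F, hF⟩ _ Set.inter_subset_left hFX r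
  have hwF := hw.trans Set.inter_subset_left
  refine ⟨w, hw.trans Set.inter_subset_right, hwi, (h𝓕.prop.1 F hF).1.mono hwF, ?_⟩
  have h : ∃ F : 𝓕, w ⊆ F.1 := ⟨⟨F, hF⟩, hwF⟩
  have heq : h.choose = ⟨F, hF⟩ := by
    by_contra hne
    exact (hwi.mono (Set.subset_inter h.choose_spec hwF))
      (h𝓕.prop.2 _ h.choose.2 F hF fun h' => hne (Subtype.ext h'))
  change (if h : ∃ F : 𝓕, w ⊆ F.1 then G h.choose w else ∅) = _
  rw [dif_pos h, heq]

/-! ### Closure under operations of countable arity. -/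

section OpClosure

variable {I : Type} {X : Type u} (op : I → (ℕ → X) → X)

/-- The closure of a set under a family of operations of countable arity. -/
inductive OpClosure (B : Set X) : X → Prop
  | base {x : X} (hx : x ∈ B) : OpClosure B x
  | app (i : I) (x : ℕ → X) (hx : ∀ k, OpClosure B (x k)) : OpClosure B (op i x)

variable {op}

theorem OpClosure.mono {B C : Set X} (h : B ⊆ C) {x : X} (hx : OpClosure op B x) :
    OpClosure op C x := by
  induction hx with
  | base hx => exact .base (h hx)
  | app i x _ ih => exact .app i x ih

theorem OpClosure.exists_countable {B : Set X} {x : X} (hx : OpClosure op B x) :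
    ∃ v ⊆ B, v.Countable ∧ OpClosure op v x := by
  induction hx with
  | base hx => exact ⟨{_}, by simpa using hx, Set.countable_singleton _, .base rfl⟩
  | app i x _ ih =>
    choose v hvB hvc hv using ih
    exact ⟨⋃ k, v k, Set.iUnion_subset hvB, Set.countable_iUnion hvc,
      .app i x fun k => (hv k).mono (Set.subset_iUnion v k)⟩

-- The trees are terms: ω-branching nodes labelled by `I`, leaves labelled by variables from `ℕ`.
-- Countably many labels suffice for the bound because 𝔠^ℵ₀ = 𝔠.
open Cardinal in
theorem mk_wType_le_continuum [Countable I] :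
    #(WType (Sum.elim (fun _ : I => ℕ) fun _ : ℕ => Empty)) ≤ continuum := by
  refine WType.cardinalMk_le_of_le ?_
  refine (sum_le_sum _ (fun _ => continuum) ?_).trans ?_
  · rintro (i | n)
    · simp [continuum_power_aleph0]
    · simpa using aleph0_le_continuum.trans' one_le_aleph0
  · rw [sum_const', ← continuum_mul_self]
    exact mul_le_mul' (mk_le_aleph0.trans (by simp [aleph0_le_continuum])) (by simp)

/-- The closure of a countable set under countably many operations has at most continuum many
elements. -/
theorem exists_surjOn_opClosure [Countable I] {B : Set X} (hB : B.Countable)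
    (hne : B.Nonempty) : ∃ e : Set ℕ → X, ∀ x, OpClosure op B x → ∃ r, e r = x := by
  obtain ⟨b, rfl⟩ := hB.exists_eq_range hne
  let W := WType (Sum.elim (fun _ : I => ℕ) fun _ : ℕ => Empty)
  have hW : Cardinal.mk W ≤ Cardinal.mk (Set ℕ) := by
    simpa using mk_wType_le_continuum (I := I)
  have : Nonempty W := ⟨⟨Sum.inr 0, Empty.elim⟩⟩
  obtain ⟨s, hs⟩ : ∃ s : Set ℕ → W, Function.Surjective s := by
    obtain ⟨f⟩ := hW
    exact ⟨_, Function.invFun_surjective f.injective⟩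
  -- Evaluation of terms, with leaf `n` read as `b n`; its values cover the closure.
  let ev : W → X := WType.elim X fun
    | ⟨Sum.inl i, x⟩ => op i x
    | ⟨Sum.inr n, _⟩ => b n
  refine ⟨ev ∘ s, fun x hx => ?_⟩
  suffices h : ∃ t, ev t = x by
    obtain ⟨t, rfl⟩ := h
    obtain ⟨r, rfl⟩ := hs t
    exact ⟨r, rfl⟩
  induction hx with
  | base hx =>
    obtain ⟨n, rfl⟩ := hx
    exact ⟨⟨Sum.inr n, Empty.elim⟩, rfl⟩
  | app i x _ ih =>
    choose t ht using ih
    refine ⟨⟨Sum.inl i, t⟩, ?_⟩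
    rw [← funext ht]
    rfl

end OpClosure

/-! ### First-order definability and absoluteness for (S, ∈). -/

open FirstOrder Language

/-- A relation on the structures `(S, ∈)` which is defined by the same formula in all of them. -/
def UniformlyDefinable {n : ℕ} (R : ∀ S : ZFSet.{u}, (Fin n → S) → Prop) : Prop :=
  ∃ φ : setTheory.BoundedFormula Empty n, ∀ (S : ZFSet.{u}) (v : Fin n → S),
    φ.Realize default v ↔ R S v

namespace UniformlyDefinable

variable {n : ℕ} {P Q : ∀ S : ZFSet.{u}, (Fin n → S) → Prop}

theorem mem (a b : Fin n) :
    UniformlyDefinable fun (_ : ZFSet.{u}) v => (v a : ZFSet.{u}) ∈ (v b : ZFSet.{u}) :=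
  ⟨Relations.boundedFormula₂ (L := setTheory) SetTheoryRel.mem
    (Term.var (Sum.inr a)) (Term.var (Sum.inr b)), fun _ _ => by
      simp only
      rfl⟩

theorem eq (a b : Fin n) : UniformlyDefinable fun (_ : ZFSet.{u}) v => v a = v b :=
  ⟨Term.bdEqual (Term.var (Sum.inr a)) (Term.var (Sum.inr b)), fun _ _ => by simp⟩

theorem not (hP : UniformlyDefinable P) : UniformlyDefinable fun S v => ¬ P S v := by
  obtain ⟨φ, hφ⟩ := hP
  exact ⟨φ.not, fun S v => by simp [hφ]⟩

theorem imp (hP : UniformlyDefinable P) (hQ : UniformlyDefinable Q) :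
    UniformlyDefinable fun S v => P S v → Q S v := by
  obtain ⟨φ, hφ⟩ := hP
  obtain ⟨ψ, hψ⟩ := hQ
  exact ⟨φ.imp ψ, fun S v => by simp [hφ, hψ]⟩

theorem and (hP : UniformlyDefinable P) (hQ : UniformlyDefinable Q) :
    UniformlyDefinable fun S v => P S v ∧ Q S v := by
  obtain ⟨φ, hφ⟩ := hP
  obtain ⟨ψ, hψ⟩ := hQ
  exact ⟨φ ⊓ ψ, fun S v => by simp [hφ, hψ]⟩

theorem or (hP : UniformlyDefinable P) (hQ : UniformlyDefinable Q) :
    UniformlyDefinable fun S v => P S v ∨ Q S v := by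
  obtain ⟨φ, hφ⟩ := hP
  obtain ⟨ψ, hψ⟩ := hQ
  exact ⟨φ ⊔ ψ, fun S v => by simp [hφ, hψ]⟩

theorem iff (hP : UniformlyDefinable P) (hQ : UniformlyDefinable Q) :
    UniformlyDefinable fun S v => (P S v ↔ Q S v) := by
  obtain ⟨φ, hφ⟩ := hP
  obtain ⟨ψ, hψ⟩ := hQ
  exact ⟨φ.iff ψ, fun S v => by simp [hφ, hψ]⟩

variable {R : ∀ S : ZFSet.{u}, (Fin n → S) → S → Prop}

theorem all (hR : UniformlyDefinable (n := n + 1)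
    fun S v => R S (fun i => v i.castSucc) (v (Fin.last n))) :
    UniformlyDefinable fun S v => ∀ x, R S v x := by
  obtain ⟨φ, hφ⟩ := hR
  refine ⟨φ.all, fun S v => ?_⟩
  simp [BoundedFormula.realize_all, hφ]

theorem ex (hR : UniformlyDefinable (n := n + 1)
    fun S v => R S (fun i => v i.castSucc) (v (Fin.last n))) :
    UniformlyDefinable fun S v => ∃ x, R S v x := by
  obtain ⟨φ, hφ⟩ := hR
  refine ⟨φ.ex, fun S v => ?_⟩
  simp [BoundedFormula.realize_ex, hφ]

/-- One formula is read in both structures, so elementarity transfers the relation in both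
directions. The closure lemmas above replace explicit formulas. -/
theorem map {M N : ZFSet.{u}} (hP : UniformlyDefinable P) (j : M ↪ₑ[setTheory] N)
    (v : Fin n → M) : P N (j ∘ v) ↔ P M v := by
  obtain ⟨φ, hφ⟩ := hP
  rw [← hφ, ← hφ, ← j.map_boundedFormula φ default v, Unique.eq_default (j ∘ default)]

end UniformlyDefinable

variable {S : ZFSet.{u}}

/-- `(a, b) ∈ f`, evaluated in `S`. -/
def MemPairIn (S : ZFSet.{u}) (a b f : S) : Prop :=
  ∃ p s t : S, (p : ZFSet.{u}) ∈ (f : ZFSet.{u}) ∧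
    (∀ x : S, (x : ZFSet.{u}) ∈ (s : ZFSet.{u}) ↔ x = a) ∧
    (∀ x : S, (x : ZFSet.{u}) ∈ (t : ZFSet.{u}) ↔ (x = a ∨ x = b)) ∧
    ∀ x : S, (x : ZFSet.{u}) ∈ (p : ZFSet.{u}) ↔ (x = s ∨ x = t)

theorem UniformlyDefinable.memPairIn {n : ℕ} (a b f : Fin n) :
    UniformlyDefinable fun (S : ZFSet.{u}) v => MemPairIn S (v a) (v b) (v f) := by
  unfold MemPairIn
  repeat' first
    | exact .mem _ _ | exact .eq _ _ | refine .and ?_ ?_ | refine .or ?_ ?_ | refine .iff ?_ ?_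
    | refine .all ?_ | refine .ex ?_

theorem memPairIn_iff (hS : S.IsTransitive) {a b f : S} :
    MemPairIn S a b f ↔ ZFSet.pair a b ∈ (f : ZFSet.{u}) := by
  constructor
  · rintro ⟨p, s, t, hpf, hs, ht, hp⟩
    have hs' : (s : ZFSet.{u}) = {(a : ZFSet.{u})} := by
      ext x
      rw [ZFSet.mem_singleton]
      exact ⟨fun hx => congrArg Subtype.val ((hs ⟨x, hS.mem_trans hx s.2⟩).1 hx),
        fun hx => hx ▸ (hs a).2 rfl⟩
    have ht' : (t : ZFSet.{u}) = {(a : ZFSet.{u}), (b : ZFSet.{u})} := by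
      ext x
      rw [ZFSet.mem_pair]
      constructor
      · intro hx
        exact ((ht ⟨x, hS.mem_trans hx t.2⟩).1 hx).imp (congrArg Subtype.val) (congrArg Subtype.val)
      · rintro (rfl | rfl)
        exacts [(ht a).2 (.inl rfl), (ht b).2 (.inr rfl)]
    have hp' : (p : ZFSet.{u}) = ZFSet.pair a b := by
      ext x
      rw [ZFSet.pair, ZFSet.mem_pair, ← hs', ← ht']
      constructor
      · intro hx
        exact ((hp ⟨x, hS.mem_trans hx p.2⟩).1 hx).imp (congrArg Subtype.val) (congrArg Subtype.val)
      · rintro (rfl | rfl)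
        exacts [(hp s).2 (.inl rfl), (hp t).2 (.inr rfl)]
    rwa [← hp']
  · intro h
    have hp := hS.mem_trans h f.2
    have hs : ({(a : ZFSet.{u})} : ZFSet.{u}) ∈ S :=
      hS.mem_trans (ZFSet.mem_pair.2 (.inl rfl)) hp
    have ht : ({(a : ZFSet.{u}), (b : ZFSet.{u})} : ZFSet.{u}) ∈ S :=
      hS.mem_trans (ZFSet.mem_pair.2 (.inr rfl)) hp
    refine ⟨⟨_, hp⟩, ⟨_, hs⟩, ⟨_, ht⟩, h, fun x => ?_, fun x => ?_, fun x => ?_⟩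
    · rw [ZFSet.mem_singleton, Subtype.ext_iff]
    · rw [ZFSet.mem_pair, Subtype.ext_iff, Subtype.ext_iff]
    · rw [Subtype.ext_iff, Subtype.ext_iff]
      exact ZFSet.mem_pair

/-- `a` and `b` are equinumerous, evaluated in `S`. -/
def EquinumIn (S : ZFSet.{u}) (a b : S) : Prop :=
  ∃ f : S, (∀ x : S, (x : ZFSet.{u}) ∈ (a : ZFSet.{u}) →
      ∃ y : S, (y : ZFSet.{u}) ∈ (b : ZFSet.{u}) ∧ MemPairIn S x y f) ∧
    (∀ y : S, (y : ZFSet.{u}) ∈ (b : ZFSet.{u}) →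
      ∃ x : S, (x : ZFSet.{u}) ∈ (a : ZFSet.{u}) ∧ MemPairIn S x y f) ∧
    ∀ x y x' y' : S, MemPairIn S x y f → MemPairIn S x' y' f → (x = x' ↔ y = y')

theorem UniformlyDefinable.equinumIn {n : ℕ} (a b : Fin n) :
    UniformlyDefinable fun (S : ZFSet.{u}) v => EquinumIn S (v a) (v b) := by
  unfold EquinumIn
  repeat' first
    | exact .mem _ _ | exact .eq _ _ | exact .memPairIn _ _ _ | refine .and ?_ ?_
    | refine .iff ?_ ?_ | refine .all ?_ | refine .ex ?_ | refine .imp ?_ ?_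

/-- A bijection that is an element of a transitive set is a true bijection. The converse requires
the bijection to belong to `S`. -/
theorem EquinumIn.card_eq (hS : S.IsTransitive) {a b : S} (h : EquinumIn S a b) :
    ZFSet.card (a : ZFSet.{u}) = ZFSet.card (b : ZFSet.{u}) := by
  obtain ⟨f, hf1, hf2, hf3⟩ := h
  choose! g hg1 hg2 using hf1
  choose! k hk1 hk2 using hf2
  rw [← Cardinal.lift_inj.{u, u + 1}, ← ZFSet.cardinalMk_coe_sort, ← ZFSet.cardinalMk_coe_sort]
  have ha : ∀ x : (a : ZFSet.{u}), (x : ZFSet.{u}) ∈ S := fun x => hS.mem_trans x.2 a.2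
  have hb : ∀ x : (b : ZFSet.{u}), (x : ZFSet.{u}) ∈ S := fun x => hS.mem_trans x.2 b.2
  let G : ↥(a : ZFSet.{u}) → ↥(b : ZFSet.{u}) := fun x => ⟨g ⟨x, ha x⟩, hg1 ⟨x, ha x⟩ x.2⟩
  refine Cardinal.mk_congr (Equiv.ofBijective G ⟨fun x y hxy => ?_, fun y => ?_⟩)
  · have h1 := hg2 ⟨x, ha x⟩ x.2
    have h2 := hg2 ⟨y, ha y⟩ y.2
    have := (hf3 _ _ _ _ h1 h2).2 
      (Subtype.ext (congrArg (fun z : ↥(b : ZFSet.{u}) => (z : ZFSet.{u})) hxy))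
    exact Subtype.ext (congrArg (fun z : S => (z : ZFSet.{u})) this)
  · have h1 := hk1 ⟨y, hb y⟩ y.2
    have h2 := hk2 ⟨y, hb y⟩ y.2
    refine ⟨⟨_, h1⟩, ?_⟩
    have := (hf3 _ _ _ _ (hg2 _ h1) h2).1 rfl
    exact Subtype.ext (congrArg (fun z : S => (z : ZFSet.{u})) this)

theorem ZFSet.pair_mem_vonNeumann {o : Ordinal.{u}} (ho : Order.IsSuccLimit o) {a b : ZFSet.{u}}
    (ha : a ∈ vonNeumann o) (hb : b ∈ vonNeumann o) : pair a b ∈ vonNeumann o := by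
  rw [mem_vonNeumann] at *
  rw [pair, rank_pair, rank_pair, rank_singleton]
  exact max_lt (ho.succ_lt (ho.succ_lt ha)) (ho.succ_lt (max_lt (ho.succ_lt ha) (ho.succ_lt hb)))

/-- Any set of pairs of elements of `V_o` is an element of `V_γ` for `γ > o`. -/
theorem exists_graph_mem_vonNeumann {o γ : Ordinal.{u}} (ho : Order.IsSuccLimit o) (hγ : o < γ)
    (R : ZFSet.{u} → ZFSet.{u} → Prop) :
    ∃ f ∈ ZFSet.vonNeumann γ, ∀ a b, ZFSet.pair a b ∈ f ↔
      a ∈ ZFSet.vonNeumann o ∧ b ∈ ZFSet.vonNeumann o ∧ R a b := by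
  refine ⟨ZFSet.sep (fun p => ∃ a ∈ ZFSet.vonNeumann o, ∃ b ∈ ZFSet.vonNeumann o,
    p = ZFSet.pair a b ∧ R a b) (ZFSet.vonNeumann o), ?_, fun a b => ?_⟩
  · rw [ZFSet.mem_vonNeumann]
    refine lt_of_le_of_lt ?_ hγ
    rw [← ZFSet.subset_vonNeumann]
    exact ZFSet.sep_subset
  · rw [ZFSet.mem_sep]
    constructor
    · rintro ⟨-, a', ha', b', hb', h, hR⟩
      obtain ⟨rfl, rfl⟩ := ZFSet.pair_injective h
      exact ⟨ha', hb', hR⟩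
    · rintro ⟨ha, hb, hR⟩
      exact ⟨ZFSet.pair_mem_vonNeumann ho ha hb, a, ha, b, hb, rfl, hR⟩

/-- Pairs of elements of V_o stay in V_o for limit o, so a bijection is a subset of V_o and hence an
element of V_γ for every γ > o. -/
theorem equinumIn_vonNeumann {o γ : Ordinal.{u}} (ho : Order.IsSuccLimit o) (hγ : o < γ)
    {a b : ZFSet.vonNeumann γ} (ha : (a : ZFSet.{u}) ⊆ ZFSet.vonNeumann o)
    (hb : (b : ZFSet.{u}) ⊆ ZFSet.vonNeumann o)
    (h : ZFSet.card (a : ZFSet.{u}) = ZFSet.card (b : ZFSet.{u})) :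
    EquinumIn (ZFSet.vonNeumann γ) a b := by
  rw [← Cardinal.lift_inj.{u, u + 1}, ← ZFSet.cardinalMk_coe_sort, ← ZFSet.cardinalMk_coe_sort] at h
  obtain ⟨e⟩ := Cardinal.eq.1 h
  have hγt := ZFSet.isTransitive_vonNeumann γ
  obtain ⟨f, hf, hfR⟩ := exists_graph_mem_vonNeumann ho hγ
    fun x y => ∃ h : x ∈ (a : ZFSet.{u}), (e ⟨x, h⟩ : ZFSet.{u}) = y
  refine ⟨⟨f, hf⟩, ?_, ?_, ?_⟩
  · intro x hx
    refine ⟨⟨e ⟨x, hx⟩, hγt.mem_trans (e ⟨x, hx⟩).2 b.2⟩, (e ⟨x, hx⟩).2, ?_⟩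
    rw [memPairIn_iff hγt, hfR]
    exact ⟨ha hx, hb (e ⟨x, hx⟩).2, hx, rfl⟩
  · intro y hy
    refine ⟨⟨e.symm ⟨y, hy⟩, hγt.mem_trans (e.symm ⟨y, hy⟩).2 a.2⟩, (e.symm ⟨y, hy⟩).2, ?_⟩
    rw [memPairIn_iff hγt, hfR]
    exact ⟨ha (e.symm ⟨y, hy⟩).2, hb hy, (e.symm ⟨y, hy⟩).2, by simp⟩
  · intro x y x' y'
    rw [memPairIn_iff hγt, memPairIn_iff hγt, hfR, hfR]
    rintro ⟨-, -, hx, hxy⟩ ⟨-, -, hx', hxy'⟩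
    rw [Subtype.ext_iff, Subtype.ext_iff, ← hxy, ← hxy', ← Subtype.ext_iff (a1 := e _),
      e.injective.eq_iff, Subtype.mk.injEq]

/-! ### Cardinals of countable cofinality. -/

theorem isSingular_of_cof_lt {lam : Cardinal.{u}} (hcof : lam.ord.cof = Cardinal.aleph0)
    (hsing : lam.ord.cof < lam) : lam.IsSingular :=
  ⟨(hcof ▸ hsing).le, hsing.ne⟩

theorem exists_seq_cofinal {o : Ordinal.{u}} (ho : o.cof = Cardinal.aleph0) :
    ∃ g : ℕ → Ordinal.{u}, (∀ n, g n < o) ∧ ∀ a < o, ∃ n, a ≤ g n := by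
  obtain ⟨s, hs, hcard⟩ := Order.exists_cof_eq (Set.Iio o)
  rw [Ordinal.cof_Iio, ← Ordinal.lift_cof, ho, Cardinal.lift_aleph0] at hcard
  have hcount : s.Countable := Cardinal.le_aleph0_iff_set_countable.1 hcard.le
  have hne : s.Nonempty := by
    rw [← Set.nonempty_coe_sort, ← Cardinal.mk_ne_zero_iff, hcard]
    exact Cardinal.aleph0_ne_zero
  obtain ⟨g, rfl⟩ := hcount.exists_eq_range hne
  refine ⟨fun n => g n, fun n => (g n).2, fun a ha => ?_⟩
  obtain ⟨_, ⟨n, rfl⟩, h⟩ := hs ⟨a, ha⟩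
  exact ⟨n, h⟩

theorem exists_seq_cardinal_cofinal {lam : Cardinal.{u}} (hcof : lam.ord.cof = Cardinal.aleph0)
    (hsing : lam.ord.cof < lam) : ∃ μ : ℕ → Cardinal.{u}, StrictMono μ ∧
      (∀ n, Cardinal.aleph0 ≤ μ n) ∧ (∀ n, μ n < lam) ∧ ∀ κ < lam, ∃ n, κ ≤ μ n := by
  obtain ⟨g, hg, hgc⟩ := exists_seq_cofinal hcof
  have hlim := (isSingular_of_cof_lt hcof hsing).isSuccLimit
  let μ : ℕ → Cardinal.{u} := fun n =>
    Nat.rec Cardinal.aleph0 (fun k c => max (Order.succ c) (g k).card) n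
  have hμ : ∀ k, μ (k + 1) = max (Order.succ (μ k)) (g k).card := fun k => rfl
  have hmono : StrictMono μ := strictMono_nat_of_lt_succ fun k =>
    (Order.lt_succ (μ k)).trans_le (hμ k ▸ le_max_left _ _)
  refine ⟨μ, hmono, fun n => hmono.monotone n.zero_le, fun n => ?_, fun κ hκ => ?_⟩
  · induction n with
    | zero => exact hcof.symm.trans_lt hsing
    | succ k ih =>
      rw [hμ]
      exact max_lt (hlim.succ_lt ih) (Cardinal.lt_ord.1 (hg k))
  · obtain ⟨n, hn⟩ := hgc κ.ord (Cardinal.ord_lt_ord.2 hκ)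
    exact ⟨n + 1, (Cardinal.ord_le.1 hn).trans (hμ n ▸ le_max_right _ _)⟩

open Cardinal in
theorem exists_large_inter {κ : ℕ → Set Ordinal.{u}} {c d : Cardinal.{u}} (hc : ℵ₀ ≤ c)
    (hcd : c < d) (hU : ∀ α < d.ord, ∃ n, α ∈ κ n) :
    ∃ n, lift.{u + 1} c < #↥(κ n ∩ Set.Iio d.ord) := by
  by_contra! hcon
  have h1 : Set.Iio d.ord ⊆ ⋃ n : ULift.{u + 1} ℕ, κ n.down ∩ Set.Iio d.ord := fun α hα => by
    obtain ⟨n, hn⟩ := hU α hα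
    exact Set.mem_iUnion.2 ⟨⟨n⟩, hn, hα⟩
  have h2 := (mk_le_mk_of_subset h1).trans (mk_iUnion_le_sum_mk.trans
    (sum_le_sum _ (fun _ => lift.{u + 1} c) fun n => hcon n.down))
  rw [mk_Iio_ordinal, card_ord, sum_const', mk_uLift, mk_nat, lift_aleph0,
    aleph0_mul_eq (by simpa using hc), lift_le] at h2
  exact h2.not_gt hcd

open Cardinal in
/-- If `λ` is singular of countable cofinality and is the increasing union of the sets `Kₙ`,
there is `A ⊆ λ` of size `λ` with bounded parts contained in members `Kₙ`, where `n` can be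
required to be large. -/
theorem exists_mk_eq_inter_subset {lam : Cardinal.{u}} (hcof : lam.ord.cof = ℵ₀)
    (hsing : lam.ord.cof < lam) {K : ℕ → Set Ordinal.{u}} (hK : Monotone K)
    (hU : ∀ α < lam.ord, ∃ n, α ∈ K n) (n₀ : Ordinal.{u} → ℕ) :
    ∃ A ⊆ Set.Iio lam.ord, #A = lift.{u + 1} lam ∧
      ∀ δ < lam.ord, ∃ δ' < lam.ord, δ ≤ δ' ∧ ∃ n ≥ n₀ δ', A ∩ Set.Iio δ' ⊆ K n := by
  obtain ⟨μ, hmono, hμ₀, hμlam, hμc⟩ := exists_seq_cardinal_cofinal hcof hsing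
  have hex : ∀ k, ∃ n, lift.{u + 1} (μ k) < #↥(K n ∩ Set.Iio (μ (k + 1)).ord) := fun k =>
    exists_large_inter (hμ₀ k) (hmono k.lt_succ_self)
      fun α hα => hU α (hα.trans (ord_lt_ord.2 (hμlam _)))
  choose m hm using hex
  -- `N` is monotone, `N k` is large enough for `n₀` at `μ k`, and `N (k + 1)` dominates `m k`. As
  -- `n₀` need not be monotone, the conclusion passes from `δ` to some `δ'` of the form `μ k`.
  let N : ℕ → ℕ := fun n =>
    Nat.rec (n₀ (μ 0).ord) (fun k l => max l (max (n₀ (μ (k + 1)).ord) (m k))) n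
  have hNs : ∀ k, N (k + 1) = max (N k) (max (n₀ (μ (k + 1)).ord) (m k)) := fun k => rfl
  have hN : Monotone N := monotone_nat_of_le_succ fun k => hNs k ▸ le_max_left _ _
  have hN₀ : ∀ k, n₀ (μ k).ord ≤ N k := fun k => by
    cases k with
    | zero => exact le_rfl
    | succ k => simp [hNs]
  have hNm : ∀ k, m k ≤ N (k + 1) := fun k => by simp [hNs]
  let A : Set Ordinal.{u} := {α | α < lam.ord ∧ ∀ k, α < (μ k).ord → α ∈ K (N k)}
  -- By definition `A` below `μ k` is inside `K (N k)`. It is still large: it contains `K (m k)`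
  -- between `μ k` and `μ (k + 1)`, which has more than `μ k` elements.
  have hAsub : A ⊆ Set.Iio lam.ord := fun α h => h.1
  have hcov : ∀ k, K (m k) ∩ Set.Iio (μ (k + 1)).ord ⊆ A ∪ Set.Iio (μ k).ord := by
    rintro k α ⟨hα, hαμ⟩
    by_cases hlt : α < (μ k).ord
    · exact Or.inr hlt
    · refine Or.inl ⟨lt_trans hαμ (ord_lt_ord.2 (hμlam _)), fun l hl => ?_⟩
      have hkl : k < l := by
        by_contra! hlk
        exact hlt (hl.trans_le (ord_le_ord.2 (hmono.monotone hlk)))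
      exact hK ((hNm k).trans (hN hkl)) hα
  have hbig : ∀ k, lift.{u + 1} (μ k) < #A := by
    intro k
    by_contra! hle
    have h := (hm k).trans_le ((mk_le_mk_of_subset (hcov k)).trans (mk_union_le _ _))
    rw [mk_Iio_ordinal, card_ord] at h
    exact h.not_ge ((add_le_add_left hle _).trans (add_eq_self (by simpa using hμ₀ k)).le)
  refine ⟨A, hAsub, le_antisymm ?_ ?_, fun δ hδ => ?_⟩
  · simpa [mk_Iio_ordinal] using mk_le_mk_of_subset hAsub
  · by_contra! hlt
    obtain ⟨κ, hκ', hκ⟩ := lt_lift_iff.1 hlt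
    obtain ⟨k, hk⟩ := hμc κ hκ'
    exact (hbig k).not_ge (hκ ▸ lift_le.2 hk)
  · obtain ⟨k, hk⟩ := hμc (Order.succ δ.card)
      ((isSingular_of_cof_lt hcof hsing).isSuccLimit.succ_lt (lt_ord.1 hδ))
    refine ⟨(μ k).ord, ord_lt_ord.2 (hμlam k), (lt_ord.2 (Order.succ_le_iff.1 hk)).le,
      N k, hN₀ k, fun α hα => hα.1.2 k hα.2⟩

/-! ### Sets of ordinals as elements of the universe. -/

/-- The set of von Neumann ordinals below `o` which correspond to elements of `W`. -/
noncomputable def ordImage (o : Ordinal.{u}) (W : Set Ordinal.{u}) : ZFSet.{u} :=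
  ZFSet.sep (fun x => x.rank ∈ W) o.toZFSet

theorem mem_ordImage {o : Ordinal.{u}} {W : Set Ordinal.{u}} {x : ZFSet.{u}} :
    x ∈ ordImage o W ↔ ∃ α ∈ W, α < o ∧ α.toZFSet = x := by
  rw [ordImage, ZFSet.mem_sep, Ordinal.mem_toZFSet_iff]
  constructor
  · rintro ⟨⟨α, hα, rfl⟩, h⟩
    exact ⟨α, by simpa using h, hα, rfl⟩
  · rintro ⟨α, h, hα, rfl⟩
    exact ⟨⟨α, hα, rfl⟩, by simpa using h⟩

theorem toZFSet_mem_ordImage {o : Ordinal.{u}} {W : Set Ordinal.{u}} {α : Ordinal.{u}} :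
    α.toZFSet ∈ ordImage o W ↔ α ∈ W ∧ α < o := by
  rw [mem_ordImage]
  constructor
  · rintro ⟨β, h, hβ, he⟩
    exact Ordinal.toZFSet_injective he ▸ ⟨h, hβ⟩
  · exact fun h => ⟨α, h.1, h.2, rfl⟩

theorem ordImage_subset (o : Ordinal.{u}) (W : Set Ordinal.{u}) : ordImage o W ⊆ o.toZFSet :=
  ZFSet.sep_subset

theorem ordImage_injOn {o : Ordinal.{u}} {W W' : Set Ordinal.{u}} (hW : W ⊆ Set.Iio o)
    (hW' : W' ⊆ Set.Iio o) (h : ordImage o W = ordImage o W') : W = W' := by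
  ext α
  constructor <;> intro hα
  · exact (toZFSet_mem_ordImage.1 (h ▸ toZFSet_mem_ordImage.2 ⟨hα, hW hα⟩)).1
  · exact (toZFSet_mem_ordImage.1 (h ▸ toZFSet_mem_ordImage.2 ⟨hα, hW' hα⟩)).1

theorem lift_card_ordImage {o : Ordinal.{u}} {W : Set Ordinal.{u}} (hW : W ⊆ Set.Iio o) :
    Cardinal.lift.{u + 1} (ordImage o W).card = Cardinal.mk W := by
  rw [← ZFSet.cardinalMk_coe_sort, ← Cardinal.mk_image_eq Ordinal.toZFSet_injective]
  refine Cardinal.mk_congr (Equiv.subtypeEquivRight fun x => ?_)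
  rw [mem_ordImage]
  exact ⟨fun ⟨α, h, _, e⟩ => ⟨α, h, e⟩, fun ⟨α, h, e⟩ => ⟨α, h, hW h, e⟩⟩

theorem card_ordImage_eq_aleph0 {o : Ordinal.{u}} {W : Set Ordinal.{u}} (hW : W ⊆ Set.Iio o)
    (hc : Cardinal.mk W = Cardinal.aleph0) : (ordImage o W).card = Cardinal.aleph0 := by
  rw [← Cardinal.lift_inj.{u, u + 1}, lift_card_ordImage hW, hc, Cardinal.lift_aleph0]

theorem eq_ordImage {o : Ordinal.{u}} {x : ZFSet.{u}} (hx : x ⊆ o.toZFSet) :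
    x = ordImage o {α | α < o ∧ α.toZFSet ∈ x} := by
  ext y
  rw [mem_ordImage]
  constructor
  · intro hy
    obtain ⟨α, hα, rfl⟩ := Ordinal.mem_toZFSet_iff.1 (hx hy)
    exact ⟨α, ⟨hα, hy⟩, hα, rfl⟩
  · rintro ⟨α, ⟨_, h⟩, _, rfl⟩
    exact h

/-! ### Failure of the Magidor property as a first-order statement. -/

/-- `z` is a countably infinite set of natural numbers, evaluated in `S`. -/
def InfiniteNatsIn (S : ZFSet.{u}) (z : S) : Prop :=
  (∃ n : S, (n : ZFSet.{u}) ∈ (z : ZFSet.{u})) ∧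
  (∀ n : S, (n : ZFSet.{u}) ∈ (z : ZFSet.{u}) →
    ∃ m : S, (m : ZFSet.{u}) ∈ (z : ZFSet.{u}) ∧ (n : ZFSet.{u}) ∈ (m : ZFSet.{u})) ∧
  ∀ n : S, (n : ZFSet.{u}) ∈ (z : ZFSet.{u}) →
    (∀ y : S, ¬ (y : ZFSet.{u}) ∈ (n : ZFSet.{u})) ∨
    ∃ m : S, (m : ZFSet.{u}) ∈ (z : ZFSet.{u}) ∧
      ∀ y : S, (y : ZFSet.{u}) ∈ (n : ZFSet.{u}) ↔ ((y : ZFSet.{u}) ∈ (m : ZFSet.{u}) ∨ y = m)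

/-- `C` codes a coloring witnessing that `l` is not a Magidor cardinal, evaluated in `S`, where
countability is expressed through the set of natural numbers `z`. -/
def CounterexampleIn (S : ZFSet.{u}) (l C z : S) : Prop :=
  (∀ w a b : S, MemPairIn S w a C → MemPairIn S w b C → a = b) ∧
  (∀ A : S, (∀ x : S, (x : ZFSet.{u}) ∈ (A : ZFSet.{u}) → (x : ZFSet.{u}) ∈ (l : ZFSet.{u})) →
    EquinumIn S A l → ∀ η : S, (η : ZFSet.{u}) ∈ (l : ZFSet.{u}) →
    ∃ w : S, MemPairIn S w η C ∧
      (∀ x : S, (x : ZFSet.{u}) ∈ (w : ZFSet.{u}) → (x : ZFSet.{u}) ∈ (A : ZFSet.{u})) ∧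
      (∃ δ : S, (δ : ZFSet.{u}) ∈ (l : ZFSet.{u}) ∧
        ∀ x : S, (x : ZFSet.{u}) ∈ (w : ZFSet.{u}) → (x : ZFSet.{u}) ∈ (δ : ZFSet.{u})) ∧
      EquinumIn S z w) ∧
  InfiniteNatsIn S z

theorem UniformlyDefinable.counterexampleIn {n : ℕ} (l C z : Fin n) :
    UniformlyDefinable fun (S : ZFSet.{u}) v => CounterexampleIn S (v l) (v C) (v z) := by
  unfold CounterexampleIn InfiniteNatsIn
  repeat' first
    | exact .mem _ _ | exact .eq _ _ | exact .memPairIn _ _ _ | exact .equinumIn _ _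
    | refine .and ?_ ?_ | refine .iff ?_ ?_ | refine .or ?_ ?_ | refine .not ?_
    | refine .all ?_ | refine .ex ?_ | refine .imp ?_ ?_

/-- By ∈-induction each element is a natural number, being empty or the successor of an element of
`z`; having no largest element, `z` is infinite. Only the cardinality of `z` matters, so it need not
be shown to be ω. -/
theorem InfiniteNatsIn.card_eq {S : ZFSet.{u}} (hS : S.IsTransitive) {z : S}
    (hz : InfiniteNatsIn S z) : ZFSet.card (z : ZFSet.{u}) = Cardinal.aleph0 := by
  obtain ⟨⟨n, hn⟩, hinf, hnat⟩ := hz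
  have hnats : ∀ x : ZFSet.{u}, x ∈ (z : ZFSet.{u}) → ∃ k : ℕ, (k : Ordinal.{u}).toZFSet = x := by
    intro x
    induction x using ZFSet.inductionOn with
    | _ x ih =>
    intro hx
    have hxS : x ∈ S := hS.mem_trans hx z.2
    rcases hnat ⟨x, hxS⟩ hx with h | ⟨m, hmz, hm⟩
    · refine ⟨0, ?_⟩
      rw [Nat.cast_zero, Ordinal.toZFSet_zero, eq_comm, ZFSet.eq_empty]
      exact fun y hy => h ⟨y, hS.mem_trans hy hxS⟩ hy
    · obtain ⟨k, hk⟩ := ih m ((hm m).2 (.inr rfl)) hmz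
      refine ⟨k + 1, ?_⟩
      rw [Nat.cast_add, Nat.cast_one, Ordinal.toZFSet_add_one, hk]
      ext y
      rw [ZFSet.mem_insert_iff]
      constructor
      · rintro (rfl | hy)
        · exact (hm m).2 (.inr rfl)
        · exact (hm ⟨y, hS.mem_trans hy m.2⟩).2 (.inl hy)
      · intro hy
        exact ((hm ⟨y, hS.mem_trans hy hxS⟩).1 hy).symm.imp (fun h => congrArg Subtype.val h) id
  have hcount : (z : Set ZFSet.{u}).Countable :=
    (Set.countable_range fun k : ℕ => (k : Ordinal.{u}).toZFSet).mono fun x hx => hnats x hx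
  have hinfinite : (z : Set ZFSet.{u}).Infinite := by
    intro hfin
    obtain ⟨x, hx, hmax⟩ := Set.exists_max_image _ ZFSet.rank hfin ⟨n, hn⟩
    obtain ⟨m, hmz, hxm⟩ := hinf ⟨x, hS.mem_trans hx z.2⟩ hx
    exact (hmax m hmz).not_gt (ZFSet.rank_lt_of_mem hxm)
  rw [← Cardinal.lift_inj.{u, u + 1}, ← ZFSet.cardinalMk_coe_sort, Cardinal.lift_aleph0]
  have := hcount.to_subtype
  have := hinfinite.to_subtype
  exact Cardinal.mk_eq_aleph0 (z : Set ZFSet.{u})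

theorem infiniteNatsIn_omega {S : ZFSet.{u}} (hS : S.IsTransitive)
    (h : Ordinal.omega0.toZFSet ∈ S) : InfiniteNatsIn S ⟨_, h⟩ := by
  have hmem : ∀ x : ZFSet.{u}, x ∈ Ordinal.omega0.toZFSet ↔
      ∃ k : ℕ, (k : Ordinal.{u}).toZFSet = x := by
    intro x
    rw [Ordinal.mem_toZFSet_iff]
    constructor
    · rintro ⟨a, ha, rfl⟩
      obtain ⟨k, rfl⟩ := Ordinal.lt_omega0.1 ha
      exact ⟨k, rfl⟩
    · rintro ⟨k, rfl⟩
      exact ⟨k, Ordinal.natCast_lt_omega0 k, rfl⟩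
  have hmk : ∀ k : ℕ, (k : Ordinal.{u}).toZFSet ∈ S := fun k =>
    hS.mem_trans ((hmem _).2 ⟨k, rfl⟩) h
  refine ⟨⟨⟨_, hmk 0⟩, (hmem _).2 ⟨0, rfl⟩⟩, ?_, ?_⟩
  · rintro ⟨n, hnS⟩ hn
    obtain ⟨k, rfl⟩ := (hmem n).1 hn
    exact ⟨⟨_, hmk (k + 1)⟩, (hmem _).2 ⟨k + 1, rfl⟩, Ordinal.toZFSet_mem_toZFSet_iff.2
      (by exact_mod_cast k.lt_succ_self)⟩
  · rintro ⟨n, hnS⟩ hn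
    obtain ⟨k, rfl⟩ := (hmem n).1 hn
    cases k with
    | zero => exact Or.inl fun y hy => by simp at hy
    | succ k =>
      refine Or.inr ⟨⟨_, hmk k⟩, (hmem _).2 ⟨k, rfl⟩, fun y => ?_⟩
      change (y : ZFSet.{u}) ∈ ((k + 1 : ℕ) : Ordinal.{u}).toZFSet ↔
        (y : ZFSet.{u}) ∈ (k : Ordinal.{u}).toZFSet ∨ _
      rw [Nat.cast_add, Nat.cast_one, Ordinal.toZFSet_add_one, ZFSet.mem_insert_iff, or_comm,
        Subtype.ext_iff]

theorem toZFSet_mem_vonNeumann {α γ : Ordinal.{u}} :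
    α.toZFSet ∈ ZFSet.vonNeumann γ ↔ α < γ := by
  rw [ZFSet.mem_vonNeumann, Ordinal.rank_toZFSet]

/-- If `λ` is not a Magidor cardinal, then `V_γ` contains a counterexample for each `γ > λ`. -/
theorem exists_counterexampleIn {lam : Cardinal.{u}} (hcof : lam.ord.cof = Cardinal.aleph0)
    (hsing : lam.ord.cof < lam) (hM : ¬ IsMagidor lam) {γ : Ordinal.{u}} (hγ : lam.ord < γ) :
    ∃ C z : ZFSet.vonNeumann γ, CounterexampleIn (ZFSet.vonNeumann γ)
      ⟨lam.ord.toZFSet, toZFSet_mem_vonNeumann.2 hγ⟩ C z := by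
  simp only [IsMagidor, not_forall, not_exists, not_and, ne_eq, not_not] at hM
  obtain ⟨c, hc⟩ := hM
  have hω : Cardinal.aleph0 < lam := hcof.symm.trans_lt hsing
  have hlim : Order.IsSuccLimit lam.ord := Cardinal.isSuccLimit_ord hω.le
  have hVt := ZFSet.isTransitive_vonNeumann γ
  have hωlam : Ordinal.omega0 < lam.ord := by
    rw [← Cardinal.ord_aleph0]
    exact Cardinal.ord_lt_ord.2 hω
  have hbd : ∀ w : boundedCountable lam, w.1 ⊆ Set.Iio lam.ord := fun w => by
    obtain ⟨δ, hδ, h⟩ := w.2.2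
    exact h.trans (Set.Iio_subset_Iio hδ.le)
  obtain ⟨C, hC, hCR⟩ := exists_graph_mem_vonNeumann hlim hγ fun x y =>
    ∃ w : boundedCountable lam, x = ordImage lam.ord w.1 ∧ y = (c w).1.toZFSet
  refine ⟨⟨C, hC⟩, ⟨_, toZFSet_mem_vonNeumann.2 (hωlam.trans hγ)⟩, ?_, ?_,
    infiniteNatsIn_omega hVt _⟩
  · intro w a b
    rw [memPairIn_iff hVt, memPairIn_iff hVt, hCR, hCR]
    rintro ⟨-, -, w₁, h₁, h₁'⟩ ⟨-, -, w₂, h₂, h₂'⟩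
    obtain rfl : w₁ = w₂ := Subtype.ext (ordImage_injOn (hbd _) (hbd _) (h₁.symm.trans h₂))
    exact Subtype.ext (h₁'.trans h₂'.symm)
  · rintro ⟨A, hAV⟩ hA hAl ⟨η, hηV⟩ hη
    have hAlam : A ⊆ lam.ord.toZFSet := fun x hx => hA ⟨x, hVt.mem_trans hx hAV⟩ hx
    obtain ⟨η, hηlam, rfl⟩ := Ordinal.mem_toZFSet_iff.1 hη
    have hcard := hAl.card_eq hVt
    simp only [Ordinal.card_toZFSet, Cardinal.card_ord] at hcard
    let W : Set Ordinal.{u} := {α | α < lam.ord ∧ α.toZFSet ∈ A}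
    have hWl : W ⊆ Set.Iio lam.ord := fun α h => h.1
    have hAW : A = ordImage lam.ord W := eq_ordImage hAlam
    obtain ⟨w, hwW, hw⟩ := hc W hWl (by rw [← lift_card_ordImage hWl, ← hAW, hcard]) ⟨η, hηlam⟩
    obtain ⟨hwc, δ, hδ, hwδ⟩ := w.2
    -- Boundedness of `w` gives it rank below λ, so the coloring is coded by a subset of V_λ; this
    -- is why every γ > λ suffices.
    have hwrank : (ordImage lam.ord w.1).rank < lam.ord := by
      refine lt_of_le_of_lt (ZFSet.rank_le_iff.2 fun x hx => ?_) hδ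
      obtain ⟨α, hα, -, rfl⟩ := mem_ordImage.1 hx
      simpa using hwδ hα
    refine ⟨⟨ordImage lam.ord w.1, ZFSet.mem_vonNeumann.2 (hwrank.trans hγ)⟩, ?_, ?_, ?_, ?_⟩
    · rw [memPairIn_iff hVt, hCR]
      exact ⟨ZFSet.mem_vonNeumann.2 hwrank, toZFSet_mem_vonNeumann.2 hηlam, w, rfl, by rw [hw]⟩
    · rintro ⟨x, _⟩ hx
      obtain ⟨α, hα, -, rfl⟩ := mem_ordImage.1 hx
      exact (hwW hα).2
    · refine ⟨⟨δ.toZFSet, toZFSet_mem_vonNeumann.2 (hδ.trans hγ)⟩,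
        Ordinal.toZFSet_mem_toZFSet_iff.2 hδ, ?_⟩
      rintro ⟨x, _⟩ hx
      obtain ⟨α, hα, -, rfl⟩ := mem_ordImage.1 hx
      exact Ordinal.toZFSet_mem_toZFSet_iff.2 (hwδ hα)
    · refine equinumIn_vonNeumann hlim hγ ?_ ?_ ?_
      · exact ZFSet.subset_vonNeumann.2 (by simpa using hωlam.le)
      · exact ZFSet.subset_vonNeumann.2 hwrank.le
      · rw [card_ordImage_eq_aleph0 (hbd w) hwc, Ordinal.card_toZFSet, Ordinal.card_omega0]

theorem exists_strictMono_cofinal {T : Set Ordinal.{u}} (hT : T.Countable) (hne : T.Nonempty)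
    (hmax : ∀ a ∈ T, ∃ b ∈ T, a < b) :
    ∃ s : ℕ → Ordinal.{u}, StrictMono s ∧ (∀ k, s k ∈ T) ∧ ∀ a ∈ T, ∃ k, a < s k := by
  obtain ⟨f, rfl⟩ := hT.exists_eq_range hne
  have hex : ∀ a k : ℕ, ∃ b : ℕ, f a < f b ∧ f k < f b := by
    intro a k
    rcases le_total (f a) (f k) with h | h
    · obtain ⟨_, ⟨b, rfl⟩, hb⟩ := hmax (f k) ⟨k, rfl⟩
      exact ⟨b, h.trans_lt hb, hb⟩
    · obtain ⟨_, ⟨b, rfl⟩, hb⟩ := hmax (f a) ⟨a, rfl⟩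
      exact ⟨b, hb, h.trans_lt hb⟩
  choose g hg hg' using hex
  let t : ℕ → ℕ := fun n => Nat.rec 0 (fun k a => g a k) n
  refine ⟨fun k => f (t k), strictMono_nat_of_lt_succ fun k => hg (t k) k,
    fun k => ⟨_, rfl⟩, ?_⟩
  rintro _ ⟨k, rfl⟩
  exact ⟨k + 1, hg' (t k) k⟩

/-! ### Elementary embeddings acting on ordinals and on countable sets. -/

section Embedding

variable {M N : ZFSet.{u}} (j : M ↪ₑ[setTheory] N)

theorem map_mem_map_iff (x y : M) :
    (j x : ZFSet.{u}) ∈ (j y : ZFSet.{u}) ↔ (x : ZFSet.{u}) ∈ (y : ZFSet.{u}) :=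
  (UniformlyDefinable.mem (n := 2) 0 1).map j ![x, y]

/-- The action on ordinals of an elementary embedding fixing `l`. -/
theorem exists_ordinal_map (hM : M.IsTransitive) {l : Ordinal.{u}} (hl : l.toZFSet ∈ M)
    (hjl : (j ⟨_, hl⟩ : ZFSet.{u}) = l.toZFSet) :
    ∃ J : Ordinal.{u} → Ordinal.{u}, StrictMonoOn J (Set.Iic l) ∧ J l = l ∧
      (∀ α < l, J α < l) ∧
      ∀ α (h : α.toZFSet ∈ M), α ≤ l → (j ⟨_, h⟩ : ZFSet.{u}) = (J α).toZFSet := by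
  have hmem : ∀ α ≤ l, α.toZFSet ∈ M := fun α h => by
    rcases h.eq_or_lt with rfl | h
    · exact hl
    · exact hM.mem_trans (Ordinal.toZFSet_mem_toZFSet_iff.2 h) hl
  have hex : ∀ α, ∃ β : Ordinal.{u}, ∀ h : α.toZFSet ∈ M, α ≤ l → (j ⟨_, h⟩ : ZFSet.{u}) = β.toZFSet := by
    intro α
    rcases lt_trichotomy α l with h | rfl | h
    · have : (j ⟨_, hmem α h.le⟩ : ZFSet.{u}) ∈ l.toZFSet := by
        rw [← hjl, map_mem_map_iff]
        exact Ordinal.toZFSet_mem_toZFSet_iff.2 h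
      obtain ⟨β, -, hβ⟩ := Ordinal.mem_toZFSet_iff.1 this
      exact ⟨β, fun _ _ => hβ.symm⟩
    · exact ⟨α, fun _ _ => hjl⟩
    · exact ⟨0, fun _ h' => absurd h' h.not_ge⟩
  choose J hJ using hex
  have hmono : StrictMonoOn J (Set.Iic l) := by
    intro α hα β hβ hlt
    rw [← Ordinal.toZFSet_mem_toZFSet_iff, ← hJ α (hmem α hα) hα, ← hJ β (hmem β hβ) hβ,
      map_mem_map_iff]
    exact Ordinal.toZFSet_mem_toZFSet_iff.2 hlt
  have hJl : J l = l := Ordinal.toZFSet_injective ((hJ l hl le_rfl).symm.trans hjl)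
  exact ⟨J, hmono, hJl, fun α hα => by
    simpa [hJl] using hmono (Set.mem_Iic.2 hα.le) (Set.mem_Iic.2 le_rfl) hα, hJ⟩

theorem StrictMonoOn.le_apply_of_lt {J : Ordinal.{u} → Ordinal.{u}} {l : Ordinal.{u}}
    (hJ : StrictMonoOn J (Set.Iic l)) {α : Ordinal.{u}} (hα : α ≤ l) : α ≤ J α := by
  induction α using WellFoundedLT.induction with
  | _ α ih =>
  by_contra! h
  exact (ih _ h (h.le.trans hα)).not_gt (hJ (h.le.trans hα) hα h)

theorem map_subset (hN : N.IsTransitive) {a b : M} (h : (a : ZFSet.{u}) ⊆ (b : ZFSet.{u})) :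
    (j a : ZFSet.{u}) ⊆ (j b : ZFSet.{u}) := fun x hx =>
  ((UniformlyDefinable.all (.imp (.mem _ _) (.mem _ _)) :
    UniformlyDefinable (n := 2) fun (S : ZFSet.{u}) v =>
      ∀ x : S, (x : ZFSet.{u}) ∈ (v 0 : ZFSet.{u}) → (x : ZFSet.{u}) ∈ (v 1 : ZFSet.{u})).map j
      ![a, b]).2 (fun _ hx => h hx) ⟨x, hN.mem_trans hx (j a).2⟩ hx

theorem map_disjoint (hN : N.IsTransitive) {a b : M}
    (h : ∀ x ∈ (a : ZFSet.{u}), x ∉ (b : ZFSet.{u})) :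
    ∀ x ∈ (j a : ZFSet.{u}), x ∉ (j b : ZFSet.{u}) := fun x hx =>
  ((UniformlyDefinable.all (.imp (.mem _ _) (.not (.mem _ _))) :
    UniformlyDefinable (n := 2) fun (S : ZFSet.{u}) v =>
      ∀ x : S, (x : ZFSet.{u}) ∈ (v 0 : ZFSet.{u}) → ¬ (x : ZFSet.{u}) ∈ (v 1 : ZFSet.{u})).map j
      ![a, b]).2 (fun x hx => h x hx) ⟨x, hN.mem_trans hx (j a).2⟩ hx

theorem map_bounded (hN : N.IsTransitive) {a b c : M}
    (h : ∀ x ∈ (a : ZFSet.{u}), x ∈ (b : ZFSet.{u}) → (c : ZFSet.{u}) ∉ x) :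
    ∀ x ∈ (j a : ZFSet.{u}), x ∈ (j b : ZFSet.{u}) → (j c : ZFSet.{u}) ∉ x := fun x hx =>
  ((UniformlyDefinable.all (.imp (.mem _ _) (.imp (.mem _ _) (.not (.mem _ _)))) :
    UniformlyDefinable (n := 3) fun (S : ZFSet.{u}) v =>
      ∀ x : S, (x : ZFSet.{u}) ∈ (v 0 : ZFSet.{u}) → (x : ZFSet.{u}) ∈ (v 1 : ZFSet.{u}) →
        ¬ (v 2 : ZFSet.{u}) ∈ (x : ZFSet.{u})).map j
      ![a, b, c]).2 (fun x hx => h x hx) ⟨x, hN.mem_trans hx (j a).2⟩ hx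

theorem map_cofinal (hM : M.IsTransitive) (hN : N.IsTransitive) {a b : M}
    (h : ∀ x ∈ (b : ZFSet.{u}), ∃ t ∈ (a : ZFSet.{u}), x ∈ t) :
    ∀ x ∈ (j b : ZFSet.{u}), ∃ t ∈ (j a : ZFSet.{u}), x ∈ t := fun x hx => by
  obtain ⟨t, ht, hxt⟩ := ((UniformlyDefinable.all (.imp (.mem _ _) (.ex (.and (.mem _ _) (.mem _ _)))) :
    UniformlyDefinable (n := 2) fun (S : ZFSet.{u}) v =>
      ∀ x : S, (x : ZFSet.{u}) ∈ (v 1 : ZFSet.{u}) →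
        ∃ t : S, (t : ZFSet.{u}) ∈ (v 0 : ZFSet.{u}) ∧ (x : ZFSet.{u}) ∈ (t : ZFSet.{u})).map j
      ![a, b]).2 (fun x hx => by
        obtain ⟨t, ht, hxt⟩ := h x hx
        exact ⟨⟨t, hM.mem_trans ht a.2⟩, ht, hxt⟩) ⟨x, hN.mem_trans hx (j b).2⟩ hx
  exact ⟨t, ht, hxt⟩

/-- For a set of ordinals, having immediate predecessors for all but the least element is the
first-order trace of order type ω that is needed below. -/
theorem map_predecessor (hM : M.IsTransitive) (hN : N.IsTransitive) {a : M}
    (h : ∀ t ∈ (a : ZFSet.{u}), (∃ x ∈ (a : ZFSet.{u}), x ∈ t) →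
      ∃ x ∈ (a : ZFSet.{u}), x ∈ t ∧ ∀ y ∈ (a : ZFSet.{u}), y ∈ t → x ∉ y) :
    ∀ t ∈ (j a : ZFSet.{u}), (∃ x ∈ (j a : ZFSet.{u}), x ∈ t) →
      ∃ x ∈ (j a : ZFSet.{u}), x ∈ t ∧ ∀ y ∈ (j a : ZFSet.{u}), y ∈ t → x ∉ y := by
  rintro t ht ⟨x, hx, hxt⟩
  have hdef : UniformlyDefinable (n := 1) fun (S : ZFSet.{u}) v =>
      ∀ t : S, (t : ZFSet.{u}) ∈ (v 0 : ZFSet.{u}) →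
        (∃ x : S, (x : ZFSet.{u}) ∈ (v 0 : ZFSet.{u}) ∧ (x : ZFSet.{u}) ∈ (t : ZFSet.{u})) →
        ∃ x : S, (x : ZFSet.{u}) ∈ (v 0 : ZFSet.{u}) ∧ (x : ZFSet.{u}) ∈ (t : ZFSet.{u}) ∧
          ∀ y : S, (y : ZFSet.{u}) ∈ (v 0 : ZFSet.{u}) → (y : ZFSet.{u}) ∈ (t : ZFSet.{u}) →
            ¬ (x : ZFSet.{u}) ∈ (y : ZFSet.{u}) := by
    repeat' first
      | exact .mem _ _ | refine .and ?_ ?_ | refine .not ?_ | refine .all ?_ | refine .ex ?_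
      | refine .imp ?_ ?_
  obtain ⟨x', hx', hxt', hmax⟩ := (hdef.map j ![a]).2 (fun t ht ⟨x, hx, hxt⟩ => by
    obtain ⟨x', hx', hxt', hmax⟩ := h t ht ⟨x, hx, hxt⟩
    exact ⟨⟨x', hM.mem_trans hx' a.2⟩, hx', hxt', fun y hy hyt => hmax y hy hyt⟩)
    ⟨t, hN.mem_trans ht (j a).2⟩ ht ⟨⟨x, hN.mem_trans hx (j a).2⟩, hx, hxt⟩
  exact ⟨x', hx', hxt', fun y hy hyt => hmax ⟨y, hN.mem_trans hy (j a).2⟩ hy hyt⟩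

/-- An elementary embedding acts pointwise on countable sets of ordinals all of whose countable
subsets belong to its domain. -/
theorem map_eq_image_of_countable (hM : M.IsTransitive) (hN : N.IsTransitive) {l : Ordinal.{u}}
    (hl : l.toZFSet ∈ M) (hjl : (j ⟨_, hl⟩ : ZFSet.{u}) = l.toZFSet) {v : ZFSet.{u}} (hvM : v ∈ M)
    (hvl : v ⊆ l.toZFSet) (hvc : v.card = Cardinal.aleph0)
    (hsub : ∀ s ⊆ v, s.card = Cardinal.aleph0 → s ∈ M) {y : ZFSet.{u}}
    (hy : y ∈ (j ⟨v, hvM⟩ : ZFSet.{u})) : ∃ x : M, (x : ZFSet.{u}) ∈ v ∧ (j x : ZFSet.{u}) = y := by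
  by_contra! hcon
  obtain ⟨J, hJmono, hJl, hJlt, hJ⟩ := exists_ordinal_map j hM hl hjl
  have hord : ∀ α ≤ l, α.toZFSet ∈ M := fun α h => by
    rcases h.eq_or_lt with rfl | h
    · exact hl
    · exact hM.mem_trans (Ordinal.toZFSet_mem_toZFSet_iff.2 h) hl
  have hsubl : ∀ s (hs : s ∈ M), s ⊆ v → (j ⟨s, hs⟩ : ZFSet.{u}) ⊆ l.toZFSet := by
    intro s hs hsv
    have := map_subset j hN (a := ⟨s, hs⟩) (b := ⟨_, hl⟩) (hsv.trans hvl)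
    rwa [hjl] at this
  obtain ⟨b, hb, rfl⟩ := Ordinal.mem_toZFSet_iff.1 (hsubl v hvM subset_rfl hy)
  have hne : ∀ α ≤ l, J α ≠ b := by
    intro α hα hαb
    refine hcon ⟨_, hord α hα⟩ ?_ (by rw [hJ α _ hα, hαb])
    have h1 : (j ⟨_, hord α hα⟩ : ZFSet.{u}) ∈ (j ⟨v, hvM⟩ : ZFSet.{u}) := by
      rwa [hJ α _ hα, hαb]
    exact (map_mem_map_iff j _ _).1 h1
  -- Suppose `b ∈ j(v)` is missed by `j''v`, and let `x` be least with `b < j(x)`. Then `v` is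
  -- cofinal in `x`: a bound `α < x` for `v ∩ x` would give `b ≤ j(α)`, whereas `j(α) < b`.
  obtain ⟨x, ⟨hxl, hbx⟩, hxmin⟩ := WellFounded.has_min (wellFounded_lt (α := Ordinal.{u}))
    {x | x ≤ l ∧ b < J x} ⟨l, le_rfl, by rwa [hJl]⟩
  have hJb : ∀ α < x, J α < b := fun α hα => lt_of_le_of_ne
    (not_lt.1 fun h => hxmin α ⟨hα.le.trans hxl, h⟩ hα) (hne α (hα.le.trans hxl))
  have hbjx : b.toZFSet ∈ (j ⟨_, hord x hxl⟩ : ZFSet.{u}) := by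
    rw [hJ x _ hxl]
    exact Ordinal.toZFSet_mem_toZFSet_iff.2 hbx
  let T : Set Ordinal.{u} := {α | α < x ∧ α.toZFSet ∈ v}
  have hTunb : ∀ α < x, ∃ β ∈ T, α < β := by
    intro α hα
    by_contra! h
    have h2 := map_bounded j hN (a := ⟨v, hvM⟩) (b := ⟨_, hord x hxl⟩)
      (c := ⟨_, hord α (hα.le.trans hxl)⟩) (fun t htv htx => by
        obtain ⟨β, hβ, rfl⟩ := Ordinal.mem_toZFSet_iff.1 htx
        rw [Ordinal.toZFSet_mem_toZFSet_iff, not_lt]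
        exact h β ⟨hβ, htv⟩) _ hy hbjx
    rw [hJ α _ (hα.le.trans hxl), Ordinal.toZFSet_mem_toZFSet_iff] at h2
    exact h2 (hJb α hα)
  have hTne : T.Nonempty := by
    by_contra h
    refine map_disjoint j hN (a := ⟨v, hvM⟩) (b := ⟨_, hord x hxl⟩) (fun t htv htx => ?_) _ hy hbjx
    obtain ⟨β, hβ, rfl⟩ := Ordinal.mem_toZFSet_iff.1 htx
    exact h ⟨β, hβ, htv⟩
  have hTc : T.Countable := by
    have hvc' : (v : Set ZFSet.{u}).Countable := by
      rw [← Cardinal.le_aleph0_iff_set_countable]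
      change Cardinal.mk v ≤ _
      rw [ZFSet.cardinalMk_coe_sort, hvc, Cardinal.lift_aleph0]
    exact (hvc'.preimage Ordinal.toZFSet_injective).mono fun α h => h.2
  -- Although M may not know that `v` is countable, the range `Z` of a cofinal ω-sequence in `v ∩ x`
  -- belongs to M and has the predecessor property.
  obtain ⟨s, hs, hsT, hsc⟩ := exists_strictMono_cofinal hTc hTne fun α h => hTunb α h.1
  have hsl : Set.range s ⊆ Set.Iio l := by
    rintro _ ⟨k, rfl⟩
    exact (hsT k).1.trans_le hxl
  let Z := ordImage l (Set.range s)
  have hZmem : ∀ t, t ∈ Z ↔ ∃ k, (s k).toZFSet = t := by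
    intro t
    rw [mem_ordImage]
    exact ⟨fun ⟨_, ⟨k, hk⟩, _, h⟩ => ⟨k, hk ▸ h⟩, fun ⟨k, hk⟩ => ⟨_, ⟨k, rfl⟩, hsl ⟨k, rfl⟩, hk⟩⟩
  have hZv : Z ⊆ v := fun t ht => by
    obtain ⟨k, rfl⟩ := (hZmem t).1 ht
    exact (hsT k).2
  have hZM : Z ∈ M := hsub Z hZv (card_ordImage_eq_aleph0 hsl (by
    rw [← Cardinal.lift_inj.{u + 1, 0}, Cardinal.mk_range_eq_of_injective hs.injective]
    simp))
  have hsk : ∀ k, s k ≤ l := fun k => (hsl ⟨k, rfl⟩).le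
  have hjs : ∀ k, (J (s k)).toZFSet ∈ (j ⟨Z, hZM⟩ : ZFSet.{u}) := fun k => by
    rw [← hJ (s k) (hord _ (hsk k)) (hsk k), map_mem_map_iff]
    exact (hZmem _).2 ⟨k, rfl⟩
  have hτex : ∃ τ : Ordinal.{u}, τ.toZFSet ∈ (j ⟨Z, hZM⟩ : ZFSet.{u}) ∧ ∀ k, J (s k) < τ := by
    obtain ⟨t, ht, hbt⟩ := map_cofinal j hM hN (a := ⟨Z, hZM⟩) (b := ⟨_, hord x hxl⟩)
      (fun y hy => by
        obtain ⟨α, hα, rfl⟩ := Ordinal.mem_toZFSet_iff.1 hy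
        obtain ⟨β, hβ, hαβ⟩ := hTunb α hα
        obtain ⟨k, hk⟩ := hsc β hβ
        exact ⟨_, (hZmem _).2 ⟨k, rfl⟩, Ordinal.toZFSet_mem_toZFSet_iff.2 (hαβ.trans hk)⟩) _ hbjx
    obtain ⟨τ, hτ, rfl⟩ := Ordinal.mem_toZFSet_iff.1 (hsubl Z hZM hZv ht)
    exact ⟨τ, ht, fun k =>
      (hJb _ (hsT k).1).trans (Ordinal.toZFSet_mem_toZFSet_iff.1 hbt)⟩
  -- The least `τ ∈ j(Z)` above all `j(s k)` cannot have an immediate predecessor `τ'` in `j(Z)`: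
  -- minimality gives `τ' ≤ j(s k)` for some `k`, and then `j(s (k + 1))` lies strictly between `τ'`
  -- and `τ`.
  obtain ⟨τ, ⟨hτZ, hτs⟩, hτmin⟩ := WellFounded.has_min (wellFounded_lt (α := Ordinal.{u})) _ hτex
  obtain ⟨x', hx'Z, hx'τ, hx'max⟩ := map_predecessor j hM hN (a := ⟨Z, hZM⟩) (by
    rintro t ht ⟨y, hy, hyt⟩
    obtain ⟨k, rfl⟩ := (hZmem t).1 ht
    obtain ⟨i, rfl⟩ := (hZmem y).1 hy
    have hik := hs.lt_iff_lt.1 (Ordinal.toZFSet_mem_toZFSet_iff.1 hyt)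
    cases k with
    | zero => exact absurd hik i.not_lt_zero
    | succ k =>
      refine ⟨_, (hZmem _).2 ⟨k, rfl⟩, Ordinal.toZFSet_mem_toZFSet_iff.2 (hs k.lt_succ_self), ?_⟩
      intro z hz hzt hkz
      obtain ⟨m, rfl⟩ := (hZmem z).1 hz
      have h1 := hs.lt_iff_lt.1 (Ordinal.toZFSet_mem_toZFSet_iff.1 hzt)
      have h2 := hs.lt_iff_lt.1 (Ordinal.toZFSet_mem_toZFSet_iff.1 hkz)
      omega) _ hτZ ⟨_, hjs 0, Ordinal.toZFSet_mem_toZFSet_iff.2 (hτs 0)⟩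
  obtain ⟨τ', hτ', rfl⟩ := Ordinal.mem_toZFSet_iff.1 hx'τ
  obtain ⟨k, hk⟩ : ∃ k, τ' ≤ J (s k) := by
    by_contra! h
    exact hτmin τ' ⟨hx'Z, h⟩ hτ'
  refine hx'max _ (hjs (k + 1)) (Ordinal.toZFSet_mem_toZFSet_iff.2 (hτs _))
    (Ordinal.toZFSet_mem_toZFSet_iff.2 (hk.trans_lt ?_))
  exact hJmono (hsk k) (hsk (k + 1)) (hs k.lt_succ_self)

end Embedding

/-! ### From a triple to the Magidor property. -/

theorem isMagidor_of_triple {lam : Cardinal.{u}} (hcof : lam.ord.cof = Cardinal.aleph0)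
    (hsing : lam.ord.cof < lam) {γ : Ordinal.{u}} (hγ : lam.ord < γ) {M : ZFSet.{u}}
    {Mseq : ℕ → setTheory.ElementarySubstructure M} {j : M ↪ₑ[setTheory] (ZFSet.vonNeumann γ)}
    (h : IsMagidorTriple lam γ M Mseq j) : IsMagidor lam := by
  by_contra hnot
  have hM := h.transitive
  have hVt := ZFSet.isTransitive_vonNeumann γ
  obtain ⟨hl, hjl⟩ := h.map_eq
  have hjl' : j ⟨_, hl⟩ = ⟨lam.ord.toZFSet, toZFSet_mem_vonNeumann.2 hγ⟩ := Subtype.ext hjl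
  obtain ⟨J, hJmono, hJl, hJlt, hJ⟩ := exists_ordinal_map j hM hl hjl
  have hord : ∀ α < lam.ord, α.toZFSet ∈ M := fun α h =>
    hM.mem_trans (Ordinal.toZFSet_mem_toZFSet_iff.2 h) hl
  obtain ⟨C, z, hCz⟩ : ∃ C z : M, CounterexampleIn M ⟨_, hl⟩ C z := by
    have hdef : UniformlyDefinable (n := 1) fun (S : ZFSet.{u}) v =>
        ∃ C z : S, CounterexampleIn S (v 0) C z := .ex (.ex (.counterexampleIn _ _ _))
    refine (hdef.map j ![⟨_, hl⟩]).1 ?_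
    change ∃ C z, CounterexampleIn _ (j ⟨_, hl⟩) C z
    rw [hjl']
    exact exists_counterexampleIn hcof hsing hnot hγ
  have hjC : CounterexampleIn (ZFSet.vonNeumann γ) (j ⟨_, hl⟩) (j C) (j z) :=
    ((UniformlyDefinable.counterexampleIn (n := 3) 0 1 2).map j ![⟨_, hl⟩, C, z]).2 hCz
  obtain ⟨hfun, hall, hnat⟩ := hjC
  let K : ℕ → Set Ordinal.{u} := fun n => {α | ∃ y ∈ Mseq n, (y : ZFSet.{u}) = α.toZFSet}
  have hK : Monotone K := fun m n hmn α ⟨y, hy, e⟩ => ⟨y, h.monotone hmn hy, e⟩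
  have hKU : ∀ α < lam.ord, ∃ n, α ∈ K n := fun α hα => by
    obtain ⟨n, hn⟩ := h.union ⟨_, hord α hα⟩
    exact ⟨n, _, hn, rfl⟩
  have hn₀ := h.countable_subsets
  choose! n₀ hn₀ using hn₀
  obtain ⟨A, hAl, hAc, hA⟩ := exists_mk_eq_inter_subset hcof hsing hK hKU n₀
  have hJA : J '' A ⊆ Set.Iio lam.ord := by
    rintro _ ⟨α, hα, rfl⟩
    exact hJlt α (hAl hα)
  have hJcard : Cardinal.mk (J '' A) = Cardinal.lift.{u + 1} lam := by
    rw [← hAc]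
    exact Cardinal.mk_image_eq_of_injOn _ _
      (hJmono.injOn.mono (hAl.trans Set.Iio_subset_Iic_self))
  obtain ⟨η, hη, hηj⟩ : ∃ η ∈ lam.ord.toZFSet, ∀ y : M, (j y : ZFSet.{u}) ≠ η := by
    simpa using h.not_subset
  have hBV : ordImage lam.ord (J '' A) ∈ ZFSet.vonNeumann γ :=
    ZFSet.mem_vonNeumann_of_subset (ordImage_subset _ _) (toZFSet_mem_vonNeumann.2 hγ)
  -- The coloring `j C` is applied to `j''A`, which belongs to V_γ but need not be in the range of
  -- `j`.
  obtain ⟨w, hwη, hwA, ⟨δ, hδ, hwδ⟩, hzw⟩ := hall ⟨_, hBV⟩ (fun x hx => by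
    rw [hjl]
    exact ordImage_subset _ _ hx) (equinumIn_vonNeumann (Cardinal.isSuccLimit_ord
      (hcof.symm.trans_lt hsing).le) hγ
      (ZFSet.subset_vonNeumann.2 ((ZFSet.rank_mono (ordImage_subset _ _)).trans (by simp)))
      (by rw [hjl]; exact Ordinal.toZFSet_subset_vonNeumann _) (by
        rw [hjl, ← Cardinal.lift_inj.{u, u + 1}, lift_card_ordImage hJA, hJcard]
        simp)) ⟨η, hVt.mem_trans hη (toZFSet_mem_vonNeumann.2 hγ)⟩ (by rwa [hjl])
  rw [hjl] at hδ
  obtain ⟨δ', hδ'l, hδ'⟩ := Ordinal.mem_toZFSet_iff.1 hδ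
  have hwc : (w : ZFSet.{u}).card = Cardinal.aleph0 :=
    (hzw.card_eq hVt).symm.trans (hnat.card_eq hVt)
  -- the preimage of `w`
  let W : Set Ordinal.{u} := {α | α ∈ A ∧ (J α).toZFSet ∈ (w : ZFSet.{u})}
  have hWl : W ⊆ Set.Iio lam.ord := fun α hα => hAl hα.1
  have hWw : ∀ x ∈ (w : ZFSet.{u}), ∃ α ∈ W, (J α).toZFSet = x := by
    intro x hx
    obtain ⟨_, ⟨α, hα, rfl⟩, -, rfl⟩ :=
      mem_ordImage.1 (hwA ⟨x, hVt.mem_trans hx w.2⟩ hx)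
    exact ⟨α, ⟨hα, hx⟩, rfl⟩
  -- Since `α ≤ J α`, a bound for `w` also bounds its preimage.
  have hWδ : ∀ α ∈ W, α < δ' := by
    intro α hα
    have h1 := hwδ ⟨_, hVt.mem_trans hα.2 w.2⟩ hα.2
    rw [← hδ'] at h1
    exact (hJmono.le_apply_of_lt (hAl hα.1).le).trans_lt (Ordinal.toZFSet_mem_toZFSet_iff.1 h1)
  let v := ordImage lam.ord W
  have hvc : v.card = Cardinal.aleph0 := by
    rw [← Cardinal.lift_inj.{u, u + 1}, lift_card_ordImage hWl, ← hwc, ← ZFSet.cardinalMk_coe_sort]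
    refine Cardinal.mk_congr (Equiv.ofBijective
      (fun α => (⟨(J α.1).toZFSet, α.2.2⟩ : ↥(w : ZFSet.{u}))) ⟨fun α β hαβ => ?_, fun x => ?_⟩)
    · have := Ordinal.toZFSet_injective
        (congrArg (fun z : ↥(w : ZFSet.{u}) => (z : ZFSet.{u})) hαβ)
      exact Subtype.ext (hJmono.injOn (Set.Iio_subset_Iic_self (hWl α.2))
        (Set.Iio_subset_Iic_self (hWl β.2)) this)
    · obtain ⟨α, hα, hx⟩ := hWw x x.2
      exact ⟨⟨α, hα⟩, Subtype.ext hx⟩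
  obtain ⟨ε, hε, hδε, n, hn, hAn⟩ := hA δ' hδ'l
  have hsub : ∀ s ⊆ v, s.card = Cardinal.aleph0 → s ∈ M := by
    intro s hsv hsc
    refine hn₀ ε hε n hn s hsc (fun x hx => ?_) fun x hx => ?_
    · obtain ⟨α, hα, -, rfl⟩ := mem_ordImage.1 (hsv hx)
      exact Ordinal.toZFSet_mem_toZFSet_iff.2 ((hWδ α hα).trans_le hδε)
    · obtain ⟨α, hα, -, rfl⟩ := mem_ordImage.1 (hsv hx)
      exact hAn ⟨hα.1, (hWδ α hα).trans_le hδε⟩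
  have hvM : v ∈ M := hsub v subset_rfl hvc
  have hjv : j ⟨v, hvM⟩ = w := by
    refine Subtype.ext (ZFSet.ext fun x => ⟨fun hx => ?_, fun hx => ?_⟩)
    · obtain ⟨y, hy, rfl⟩ := map_eq_image_of_countable j hM hVt hl hjl hvM (ordImage_subset _ _) hvc
        hsub hx
      obtain ⟨y, hyM⟩ := y
      obtain ⟨α, hα, hαl, rfl⟩ := mem_ordImage.1 hy
      rw [hJ α hyM hαl.le]
      exact hα.2
    · obtain ⟨α, hα, rfl⟩ := hWw x hx
      rw [← hJ α (hord α (hWl hα)) (hWl hα).le, map_mem_map_iff]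
      exact toZFSet_mem_ordImage.2 ⟨hα, hWl hα⟩
  have hdef : UniformlyDefinable (n := 2) fun (S : ZFSet.{u}) v =>
      ∃ a : S, MemPairIn S (v 0) a (v 1) := .ex (.memPairIn _ _ _)
  -- Because `w = j(v)` is in the domain of `j C`, elementarity puts `v` in the domain of `C`; its
  -- color `a` satisfies `j a = η`.
  obtain ⟨a, ha⟩ := (hdef.map j ![⟨v, hvM⟩, C]).1 ⟨_, by
    change MemPairIn _ (j ⟨v, hvM⟩) _ (j C)
    rw [hjv]
    exact hwη⟩
  have hja : MemPairIn _ (j ⟨v, hvM⟩) (j a) (j C) :=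
    ((UniformlyDefinable.memPairIn (n := 3) 0 1 2).map j ![⟨v, hvM⟩, a, C]).2 ha
  rw [hjv] at hja
  exact hηj a (congrArg Subtype.val (hfun _ _ _ hja hwη))

/-! ### Skolem hulls closed under countable sets. -/

section SkolemClosed

variable {V : ZFSet.{u}}

/-- A set satisfying the Tarski-Vaught criterion in `(V, ∈)`. -/
def SkolemClosed (N : Set V) : Prop :=
  ∀ (n : ℕ) (φ : setTheory.BoundedFormula Empty (n + 1)) (x : Fin n → V), (∀ i, x i ∈ N) →
    (∃ a, φ.Realize default (Fin.snoc x a : Fin (n + 1) → V)) →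
      ∃ b ∈ N, φ.Realize default (Fin.snoc x b : Fin (n + 1) → V)

theorem SkolemClosed.exists_mem {N : Set V} (hN : SkolemClosed N) {n : ℕ}
    {R : ∀ S : ZFSet.{u}, (Fin n → S) → S → Prop} (hR : UniformlyDefinable (n := n + 1)
      fun S v => R S (fun i => v i.castSucc) (v (Fin.last n)))
    {x : Fin n → V} (hx : ∀ i, x i ∈ N) (h : ∃ a, R V x a) : ∃ b ∈ N, R V x b := by
  obtain ⟨φ, hφ⟩ := hR
  simpa [hφ] using hN n φ x hx (by simpa [hφ] using h)

theorem SkolemClosed.iUnion {N : ℕ → Set V} (hN : ∀ n, SkolemClosed (N n)) (hmono : Monotone N) :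
    SkolemClosed (⋃ n, N n) := by
  intro n φ x hx h
  simp only [Set.mem_iUnion] at hx
  choose m hm using hx
  obtain ⟨k, hk⟩ : ∃ k, ∀ i, m i ≤ k := ⟨Finset.univ.sup m, fun i => Finset.le_sup (Finset.mem_univ i)⟩
  obtain ⟨b, hb, hφ⟩ := hN k n φ x (fun i => hmono (hk i) (hm i)) h
  exact ⟨b, Set.mem_iUnion.2 ⟨k, hb⟩, hφ⟩

theorem SkolemClosed.ext {N : Set V} (hN : SkolemClosed N) (hV : V.IsTransitive) {x y : V}
    (hx : x ∈ N) (hy : y ∈ N)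
    (h : ∀ z ∈ N, (z : ZFSet.{u}) ∈ (x : ZFSet.{u}) ↔ (z : ZFSet.{u}) ∈ (y : ZFSet.{u})) :
    x = y := by
  by_contra hne
  have hdef : UniformlyDefinable (n := 3) fun (S : ZFSet.{u}) v =>
      ¬ ((v (Fin.last 2) : ZFSet.{u}) ∈ (v (Fin.castSucc 0) : ZFSet.{u}) ↔
        (v (Fin.last 2) : ZFSet.{u}) ∈ (v (Fin.castSucc 1) : ZFSet.{u})) :=
    .not (.iff (.mem _ _) (.mem _ _))
  obtain ⟨b, hb, hb'⟩ := hN.exists_mem (R := fun (S : ZFSet.{u}) v z =>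
      ¬ ((z : ZFSet.{u}) ∈ (v 0 : ZFSet.{u}) ↔ (z : ZFSet.{u}) ∈ (v 1 : ZFSet.{u}))) hdef
      (x := ![x, y]) (fun i => by fin_cases i <;> assumption) (by
        by_contra! hcon
        refine hne (Subtype.ext (ZFSet.ext fun z => ⟨fun hz => ?_, fun hz => ?_⟩))
        · exact (hcon ⟨z, hV.mem_trans hz x.2⟩).1 hz
        · exact (hcon ⟨z, hV.mem_trans hz y.2⟩).2 hz)
  exact hb' (h b hb)

/-- The operations on `V` whose closed sets are the Skolem closed sets which contain all their
countable subsets belonging to `V`. -/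
noncomputable def skolemOp (V : ZFSet.{u}) :
    ((Σ n, setTheory.BoundedFormula Empty (n + 1)) ⊕ Unit) → (ℕ → V) → V :=
  open Classical in fun
  | .inl ⟨n, φ⟩, x =>
    -- The fallback `x 0`, here and below, makes the operations total without enlarging closed sets.
    if h : ∃ a, φ.Realize default (Fin.snoc (fun i : Fin n => x i) a : Fin (n + 1) → V) then
      h.choose else x 0
  | .inr _, x =>
    if h : ZFSet.range (fun k => (x k : ZFSet.{u})) ∈ V then ⟨_, h⟩ else x 0

instance : Countable ((Σ n, setTheory.BoundedFormula Empty (n + 1)) ⊕ Unit) := by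
  have h1 : Countable (Σ l, setTheory.Functions l) := by
    have : ∀ l, Countable (setTheory.Functions l) := fun l => inferInstanceAs (Countable Empty)
    infer_instance
  have h2 : Countable (Σ l, setTheory.Relations l) := by
    have : ∀ l, Countable (setTheory.Relations l) := fun l => by
      have : Subsingleton (SetTheoryRel l) := ⟨fun a b => by cases a; cases b; rfl⟩
      exact inferInstanceAs (Countable (SetTheoryRel l))
    infer_instance
  have h3 : Countable setTheory.Symbols := inferInstanceAs (Countable (_ ⊕ _))
  have h4 : Countable (Σ n, setTheory.BoundedFormula Empty n) := inferInstance
  have h5 : Countable (Σ n, setTheory.BoundedFormula Empty (n + 1)) := by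
    refine Function.Injective.countable
      (f := fun p => (⟨p.1 + 1, p.2⟩ : Σ n, setTheory.BoundedFormula Empty n)) ?_
    rintro ⟨n, φ⟩ ⟨m, ψ⟩ h
    simp only [Sigma.mk.injEq, Nat.add_right_cancel_iff] at h
    obtain ⟨rfl, h⟩ := h
    rw [eq_of_heq h]
  infer_instance

theorem skolemClosed_opClosure {B : Set V} (hB : B.Nonempty) :
    SkolemClosed {x | OpClosure (skolemOp V) B x} := by
  obtain ⟨x₀, hx₀⟩ := hB
  intro n φ x hx h
  obtain ⟨y, hy, rfl⟩ : ∃ y : ℕ → V, (∀ k, OpClosure (skolemOp V) B (y k)) ∧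
      (fun i : Fin n => y i) = x := by
    -- Finite tuples are padded by `x₀` to ω-sequences, hence the need for `B` to be nonempty.
    refine ⟨fun k => if hk : k < n then x ⟨k, hk⟩ else x₀, fun k => ?_, by ext i; simp⟩
    by_cases hk : k < n
    · simpa [hk] using hx ⟨k, hk⟩
    · simpa [hk] using OpClosure.base hx₀
  refine ⟨skolemOp V (.inl ⟨n, φ⟩) y, .app _ _ hy, ?_⟩
  simpa only [skolemOp, dif_pos h] using h.choose_spec

theorem range_mem_opClosure {B : Set V} {x : ℕ → V} (hx : ∀ k, OpClosure (skolemOp V) B (x k))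
    (h : ZFSet.range (fun k => (x k : ZFSet.{u})) ∈ V) : OpClosure (skolemOp V) B ⟨_, h⟩ := by
  have := OpClosure.app (op := skolemOp V) (.inr ()) x hx
  simpa only [skolemOp, dif_pos h] using this

end SkolemClosed

/-! ### Mostowski collapse and construction of the triple. -/

section Collapse

/-- The Mostowski collapse of `x` relative to `N`. -/
noncomputable def mostowski (N : Set ZFSet.{u}) (x : ZFSet.{u}) : ZFSet.{u} :=
  ZFSet.range fun y : {y : x // (y : ZFSet.{u}) ∈ N} => mostowski N y
termination_by x
decreasing_by exact y.1.2

variable {N : Set ZFSet.{u}}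

theorem mem_mostowski {x z : ZFSet.{u}} :
    z ∈ mostowski N x ↔ ∃ y ∈ x, y ∈ N ∧ mostowski N y = z := by
  rw [mostowski, ZFSet.mem_range]
  exact ⟨fun ⟨y, hy⟩ => ⟨y, y.1.2, y.2, hy⟩, fun ⟨y, hx, hN, h⟩ => ⟨⟨⟨y, hx⟩, hN⟩, h⟩⟩

theorem mostowski_injOn
    (hext : ∀ x ∈ N, ∀ y ∈ N, (∀ z ∈ N, z ∈ x ↔ z ∈ y) → x = y) : Set.InjOn (mostowski N) N := by
  intro x
  induction x using ZFSet.inductionOn with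
  | _ x ih =>
  intro hx y hy hxy
  refine hext x hx y hy fun z hz => ⟨fun hzx => ?_, fun hzy => ?_⟩
  · obtain ⟨w, hwy, hw, h⟩ := mem_mostowski.1 (hxy ▸ mem_mostowski.2 ⟨z, hzx, hz, rfl⟩)
    rwa [ih z hzx hz hw h.symm]
  · obtain ⟨w, hwx, hw, h⟩ := mem_mostowski.1 (hxy.symm ▸ mem_mostowski.2 ⟨z, hzy, hz, rfl⟩)
    rwa [← ih w hwx hw hz h]

theorem mostowski_mem_mostowski_iff (hinj : Set.InjOn (mostowski N) N) {x y : ZFSet.{u}}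
    (hx : x ∈ N) : mostowski N x ∈ mostowski N y ↔ x ∈ y := by
  rw [mem_mostowski]
  exact ⟨fun ⟨z, hzy, hz, h⟩ => hinj hz hx h ▸ hzy, fun h => ⟨x, h, hx, rfl⟩⟩

theorem mostowski_toZFSet (N : Set ZFSet.{u}) (α : Ordinal.{u}) :
    ∃ β ≤ α, mostowski N α.toZFSet = β.toZFSet := by
  have htrans : ∀ α : Ordinal.{u}, (mostowski N α.toZFSet).IsTransitive := by
    intro α y hy z hz
    obtain ⟨y, hyα, -, rfl⟩ := mem_mostowski.1 hy
    obtain ⟨z, hzy, hzN, rfl⟩ := mem_mostowski.1 hz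
    exact mem_mostowski.2
      ⟨z, (ZFSet.isOrdinal_toZFSet α).isTransitive.mem_trans hzy hyα, hzN, rfl⟩
  have hord : ∀ α : Ordinal.{u}, (mostowski N α.toZFSet).IsOrdinal := by
    refine fun α => ⟨htrans α, fun {x y w} hxy hyw hw => ?_⟩
    obtain ⟨w, hwα, -, rfl⟩ := mem_mostowski.1 hw
    obtain ⟨β, -, rfl⟩ := Ordinal.mem_toZFSet_iff.1 hwα
    exact (htrans β).mem_trans hxy hyw
  induction α using WellFoundedLT.induction with
  | _ α ih =>
  refine ⟨_, ?_, (hord α).toZFSet_rank_eq.symm⟩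
  refine ZFSet.rank_le_iff.2 fun y hy => ?_
  obtain ⟨y, hyα, -, rfl⟩ := mem_mostowski.1 hy
  obtain ⟨β, hβ, rfl⟩ := Ordinal.mem_toZFSet_iff.1 hyα
  obtain ⟨β', hβ', h⟩ := ih β hβ
  rw [h, Ordinal.rank_toZFSet]
  exact hβ'.trans_lt hβ

end Collapse

/-- The Mostowski collapse of a union of a chain of Skolem closed subsets of `V_γ` with suitable
closure properties yields a Magidor triple. -/
theorem exists_magidorTriple {lam : Cardinal.{u}} {γ : Ordinal.{u}} (hγ : lam.ord < γ)
    {N : ℕ → Set (ZFSet.vonNeumann γ)} (hN : ∀ n, SkolemClosed (N n)) (hmono : Monotone N)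
    (hlam : ∃ n, ⟨lam.ord.toZFSet, toZFSet_mem_vonNeumann.2 hγ⟩ ∈ N n)
    (hcard : Cardinal.lift.{u + 1} lam ≤ Cardinal.mk
      {α : Ordinal.{u} | α < lam.ord ∧ ∃ n, ∃ x ∈ N n, (x : ZFSet.{u}) = α.toZFSet})
    {η : Ordinal.{u}} (hη : η < lam.ord) (hηN : ∀ n, ∀ x ∈ N n, (x : ZFSet.{u}) ≠ η.toZFSet)
    (hclosed : ∀ n, ∀ x : ℕ → ZFSet.vonNeumann γ, (∀ k, x k ∈ N n) →
      ∀ h : ZFSet.range (fun k => (x k : ZFSet.{u})) ∈ ZFSet.vonNeumann γ, ⟨_, h⟩ ∈ N n) :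
    ∃ (M : ZFSet.{u}) (Mseq : ℕ → setTheory.ElementarySubstructure M)
      (j : M ↪ₑ[setTheory] (ZFSet.vonNeumann γ)), IsMagidorTriple lam γ M Mseq j := by
  have hVt := ZFSet.isTransitive_vonNeumann γ
  have hNU := SkolemClosed.iUnion hN hmono
  let N' : Set ZFSet.{u} := Subtype.val '' ⋃ n, N n
  have hinj : Set.InjOn (mostowski N') N' := by
    refine mostowski_injOn ?_
    rintro _ ⟨x, hx, rfl⟩ _ ⟨y, hy, rfl⟩ h
    exact congrArg Subtype.val (hNU.ext hVt hx hy fun z hz => h z ⟨z, hz, rfl⟩)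
  -- The collapse is taken relative to `N'`, so collapsing all of V_γ gives exactly the set of
  -- collapses of members of `N'`.
  let M := mostowski N' (ZFSet.vonNeumann γ)
  have hMmem : ∀ z, z ∈ M ↔ ∃ x ∈ ⋃ n, N n, mostowski N' (x : ZFSet.{u}) = z := by
    intro z
    refine mem_mostowski.trans ⟨?_, ?_⟩
    · rintro ⟨_, -, ⟨x, hx, rfl⟩, h⟩
      exact ⟨x, hx, h⟩
    · rintro ⟨x, hx, h⟩
      exact ⟨x, x.2, ⟨x, hx, rfl⟩, h⟩
  have hMt : M.IsTransitive := by
    intro y hy z hz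
    obtain ⟨x, -, rfl⟩ := (hMmem y).1 hy
    obtain ⟨_, -, ⟨w, hw, rfl⟩, rfl⟩ := mem_mostowski.1 hz
    exact (hMmem _).2 ⟨w, hw, rfl⟩
  have hex : ∀ m : M, ∃ x ∈ ⋃ n, N n, mostowski N' (x : ZFSet.{u}) = m := fun m =>
    (hMmem m).1 m.2
  choose f hfN hfm using hex
  have hf : ∀ x (hx : x ∈ ⋃ n, N n), f ⟨_, (hMmem _).2 ⟨x, hx, rfl⟩⟩ = x := fun x hx =>
    Subtype.ext (hinj ⟨_, hfN _, rfl⟩ ⟨_, hx, rfl⟩ (hfm _))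
  let e : M ↪[setTheory] (ZFSet.vonNeumann γ) :=
    { toFun := f
      inj' := fun x y h => Subtype.ext (by rw [← hfm x, ← hfm y, h])
      map_fun' := fun g => g.elim
      map_rel' := fun r x => by
        cases r
        change (f (x 0) : ZFSet.{u}) ∈ (f (x 1) : ZFSet.{u}) ↔ (x 0 : ZFSet.{u}) ∈ (x 1 : ZFSet.{u})
        have := mostowski_mem_mostowski_iff hinj (y := (f (x 1) : ZFSet.{u})) ⟨_, hfN (x 0), rfl⟩
        rw [hfm, hfm] at this
        exact this.symm }
  have he : ∀ m, e m = f m := fun m => rfl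
  let j : M ↪ₑ[setTheory] (ZFSet.vonNeumann γ) := e.toElementaryEmbedding fun n φ x a h => by
    obtain ⟨b, hb, hφ⟩ := hNU n φ (e ∘ x) (fun i => hfN _) ⟨a, h⟩
    exact ⟨⟨_, (hMmem _).2 ⟨b, hb, rfl⟩⟩, by rwa [he, hf b hb]⟩
  have hj : ∀ m, j m = f m := fun m => rfl
  let Mseq : ℕ → setTheory.ElementarySubstructure M := fun n =>
    Substructure.toElementarySubstructure
      ⟨{m | j m ∈ N n}, fun g => g.elim⟩ fun k φ x a h => by
        rw [← j.map_boundedFormula, Fin.comp_snoc] at h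
        obtain ⟨b, hb, hφ⟩ := hN n k φ _ (fun i => (x i).2) ⟨_, by
          rwa [Unique.eq_default (j ∘ default)] at h⟩
        have hb' := Set.mem_iUnion.2 ⟨n, hb⟩
        refine ⟨⟨⟨_, (hMmem _).2 ⟨b, hb', rfl⟩⟩, ?_⟩, ?_⟩
        · change f _ ∈ N n
          rwa [hf b hb']
        · rw [← j.map_boundedFormula, Fin.comp_snoc, Unique.eq_default (j ∘ default), hj, hf b hb']
          exact hφ
  obtain ⟨n₀, hn₀⟩ := hlam
  have hlamN := Set.mem_iUnion.2 ⟨n₀, hn₀⟩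
  -- The collapse of λ is an ordinal at most λ with at least λ many elements, so it is λ because λ
  -- is a cardinal.
  have hπlam : mostowski N' lam.ord.toZFSet = lam.ord.toZFSet := by
    obtain ⟨β, hβ, h⟩ := mostowski_toZFSet N' lam.ord
    rw [h]
    refine congrArg _ (le_antisymm hβ ?_)
    rw [Cardinal.ord_le, ← Ordinal.card_toZFSet, ← h, ← Cardinal.lift_le.{u + 1},
      ← ZFSet.cardinalMk_coe_sort]
    refine hcard.trans (Cardinal.mk_le_of_injective (f := fun α =>
      (⟨mostowski N' α.1.toZFSet, mem_mostowski.2 ⟨_, Ordinal.toZFSet_mem_toZFSet_iff.2 α.2.1, by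
        obtain ⟨n, x, hx, h⟩ := α.2.2
        exact ⟨x, Set.mem_iUnion.2 ⟨n, hx⟩, h⟩, rfl⟩⟩ :
          ↥(mostowski N' lam.ord.toZFSet))) fun α β hαβ => ?_)
    obtain ⟨n, x, hx, hxα⟩ := α.2.2
    obtain ⟨m, y, hy, hyβ⟩ := β.2.2
    exact Subtype.ext (Ordinal.toZFSet_injective (hinj ⟨x, Set.mem_iUnion.2 ⟨n, hx⟩, hxα⟩
      ⟨y, Set.mem_iUnion.2 ⟨m, hy⟩, hyβ⟩
      (congrArg (fun z : ↥(mostowski N' lam.ord.toZFSet) => (z : ZFSet.{u})) hαβ)))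
  have hlM : lam.ord.toZFSet ∈ M := (hMmem _).2 ⟨_, hlamN, hπlam⟩
  have hjl : (j ⟨_, hlM⟩ : ZFSet.{u}) = lam.ord.toZFSet := by
    refine hinj ⟨_, hfN _, rfl⟩ ⟨_, hlamN, rfl⟩ ?_
    rw [hfm, hπlam]
  obtain ⟨J, hJmono, hJl, hJlt, hJ⟩ := exists_ordinal_map j hMt hlM hjl
  have hord : ∀ α < lam.ord, α.toZFSet ∈ M := fun α h =>
    hMt.mem_trans (Ordinal.toZFSet_mem_toZFSet_iff.2 h) hlM
  have hηj : ∀ m : M, (j m : ZFSet.{u}) ≠ η.toZFSet := fun m h => by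
    obtain ⟨n, hn⟩ := Set.mem_iUnion.1 (hfN m)
    exact hηN n _ hn h
  refine ⟨M, Mseq, j, hMt, ?_, ?_, ⟨hlM, hjl⟩, ?_, ?_, ?_, ?_⟩
  · rw [Ordinal.toZFSet_add_one]
    intro x hx
    rcases ZFSet.mem_insert_iff.1 hx with rfl | hx
    · exact hlM
    · exact hMt.mem_trans hx hlM
  -- As η is not in the range of `j`, it is moved; the critical point is therefore at most η.
  · have hηη : η < J η := by
      refine lt_of_le_of_ne (hJmono.le_apply_of_lt hη.le) fun h => hηj ⟨_, hord η hη⟩ ?_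
      rw [hJ η _ hη.le, ← h]
    have hηS : ∃ h : η.toZFSet ∈ M, η.toZFSet ∈ (j ⟨η.toZFSet, h⟩ : ZFSet.{u}) := by
      refine ⟨hord η hη, ?_⟩
      rw [hJ η _ hη.le]
      exact Ordinal.toZFSet_mem_toZFSet_iff.2 hηη
    obtain ⟨κ, hκ, hκmin⟩ := WellFounded.has_min (wellFounded_lt (α := Ordinal.{u}))
      {β : Ordinal.{u} | ∃ h : β.toZFSet ∈ M, β.toZFSet ∈ (j ⟨β.toZFSet, h⟩ : ZFSet.{u})} ⟨η, hηS⟩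
    exact ⟨κ, (not_lt.1 (hκmin η hηS)).trans_lt hη, hκ, fun β hβ => not_lt.1 (hκmin β hβ)⟩
  · intro m n hmn x hx
    exact hmono hmn hx
  · intro x
    obtain ⟨n, hn⟩ := Set.mem_iUnion.1 (hfN x)
    exact ⟨n, hn⟩
  · intro δ hδ
    -- Each `N n` is closed under countable sets, so 0 works for every δ: the image of `v` lies in
    -- `N n` and collapses back to `v`.
    refine ⟨0, fun n _ v hvc hvδ hvM => ?_⟩
    have hv : Cardinal.mk v = Cardinal.aleph0 := by
      rw [ZFSet.cardinalMk_coe_sort, hvc, Cardinal.lift_aleph0]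
    have hcount : Countable v := Cardinal.mk_le_aleph0_iff.1 hv.le
    have hne : Nonempty v := Cardinal.mk_ne_zero_iff.1 (hv ▸ Cardinal.aleph0_ne_zero)
    obtain ⟨g, hg⟩ := exists_surjective_nat v
    have hgM : ∀ k, (g k : ZFSet.{u}) ∈ M := fun k => by
      obtain ⟨y, -, h⟩ := hvM _ (g k).2
      exact h ▸ y.2
    have hgN : ∀ k, f ⟨_, hgM k⟩ ∈ N n := fun k => by
      obtain ⟨y, hy, h⟩ := hvM _ (g k).2
      have : y = ⟨_, hgM k⟩ := Subtype.ext h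
      exact this ▸ hy
    have hs : ZFSet.range (fun k => (f ⟨_, hgM k⟩ : ZFSet.{u})) ∈ ZFSet.vonNeumann γ := by
      refine ZFSet.mem_vonNeumann_of_subset (y := lam.ord.toZFSet) (fun z hz => ?_)
        (toZFSet_mem_vonNeumann.2 hγ)
      obtain ⟨k, rfl⟩ := ZFSet.mem_range.1 hz
      rw [← hjl, ← hj, map_mem_map_iff]
      exact Ordinal.toZFSet_monotone hδ.le (hvδ (g k).2)
    have hsN := hclosed n _ hgN hs
    refine (hMmem _).2 ⟨_, Set.mem_iUnion.2 ⟨n, hsN⟩, ?_⟩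
    ext z
    rw [mem_mostowski]
    constructor
    · rintro ⟨y, hy, -, rfl⟩
      obtain ⟨k, rfl⟩ := ZFSet.mem_range.1 hy
      rw [hfm]
      exact (g k).2
    · intro hz
      obtain ⟨k, hk⟩ := hg ⟨z, hz⟩
      refine ⟨f ⟨_, hgM k⟩, ZFSet.mem_range.2 ⟨k, rfl⟩, ⟨_, hfN _, rfl⟩, ?_⟩
      rw [hfm]
      exact congrArg (fun x : v => (x : ZFSet.{u})) hk
  · intro h
    obtain ⟨y, hy⟩ := h _ (Ordinal.toZFSet_mem_toZFSet_iff.2 hη)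
    exact hηj y hy

/-! ### The first ω elements of a set of ordinals. -/

/-- The elements of `A` with only finitely many predecessors in `A`. -/
def initialPart (A : Set Ordinal.{u}) : Set Ordinal.{u} :=
  {a ∈ A | (A ∩ Set.Iio a).Finite}

theorem initialPart_countable (A : Set Ordinal.{u}) : (initialPart A).Countable := by
  have hinj : Set.InjOn (fun a => (A ∩ Set.Iio a).ncard) (initialPart A) := by
    have hlt : ∀ a ∈ initialPart A, ∀ b ∈ initialPart A, a < b →
        (A ∩ Set.Iio a).ncard < (A ∩ Set.Iio b).ncard := fun a ha b hb hab =>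
      Set.ncard_lt_ncard ⟨Set.inter_subset_inter_right A (Set.Iio_subset_Iio hab.le),
        fun h => lt_irrefl a (h ⟨ha.1, hab⟩).2⟩ hb.2
    intro a ha b hb hab
    rcases lt_trichotomy a b with h | h | h
    · exact absurd hab (hlt a ha b hb h).ne
    · exact h
    · exact absurd hab (hlt b hb a ha h).ne'
  exact Set.MapsTo.countable_of_injOn (t := Set.univ) (fun _ _ => trivial) hinj Set.countable_univ

theorem initialPart_infinite {A : Set Ordinal.{u}} (hA : A.Infinite) :
    (initialPart A).Infinite := by
  intro hfin
  obtain ⟨a, ha, hmin⟩ := WellFounded.has_min (wellFounded_lt (α := Ordinal.{u}))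
    (A \ initialPart A) (hA.sdiff hfin).nonempty
  refine ha.2 ⟨ha.1, hfin.subset fun b hb => ?_⟩
  by_contra h
  exact hmin b ⟨hb.1, h⟩ hb.2

theorem lt_of_mem_initialPart {A : Set Ordinal.{u}} {a b : Ordinal.{u}} (ha : a ∈ initialPart A)
    (hb : b ∈ A \ initialPart A) : a < b := by
  by_contra! h
  exact hb.2 ⟨hb.1, ha.2.subset (Set.inter_subset_inter_right A (Set.Iio_subset_Iio h))⟩

/-- Every element of `v` has the infinite set `w` below it. This lets the coloring recover `w` and
`v` from `w ∪ v`. -/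
theorem initialPart_union {A w v : Set Ordinal.{u}} (hw : w ⊆ initialPart A) (hwi : w.Infinite)
    (hv : v ⊆ A \ initialPart A) : initialPart (w ∪ v) = w := by
  ext a
  constructor
  · rintro ⟨ha | ha, hfin⟩
    · exact ha
    · exact (hwi (hfin.subset fun b hb =>
        ⟨Or.inl hb, lt_of_mem_initialPart (hw hb) (hv ha)⟩)).elim
  · intro ha
    refine ⟨Or.inl ha, (hw ha).2.subset (Set.inter_subset_inter_left _ ?_)⟩
    exact Set.union_subset (fun b hb => (hw hb).1) fun b hb => (hv hb).1

open Cardinal in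
theorem mk_diff_initialPart {lam : Cardinal.{u}} (hlam : ℵ₀ < lam) {A : Set Ordinal.{u}}
    (hA : #A = lift.{u + 1} lam) : lift.{u + 1} lam ≤ #↥(A \ initialPart A) := by
  by_contra! hlt
  have hlam' : ℵ₀ < lift.{u + 1} lam := by simpa using hlam
  have h := add_lt_of_lt hlam'.le hlt
    ((le_aleph0_iff_set_countable.2 (initialPart_countable A)).trans_lt hlam')
  rw [← hA] at h
  refine h.not_ge ((mk_le_mk_of_subset (t := A \ initialPart A ∪ initialPart A) ?_).trans
    (mk_union_le _ _))
  rw [Set.sdiff_union_self]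
  exact Set.subset_union_left

/-! ### Hulls of sets of ordinals and the triple from a Magidor cardinal. -/

section Hull

variable {V : ZFSet.{u}}

/-- The elements of `V` which are von Neumann ordinals with index in `v`, together with `l`. -/
def ordinalBase (l : V) (v : Set Ordinal.{u}) : Set V :=
  insert l {x | ∃ α ∈ v, (x : ZFSet.{u}) = α.toZFSet}

theorem ordinalBase_mono (l : V) {v v' : Set Ordinal.{u}} (h : v ⊆ v') :
    ordinalBase l v ⊆ ordinalBase l v' :=
  Set.insert_subset_insert fun _ ⟨α, hα, hx⟩ => ⟨α, h hα, hx⟩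

theorem ordinalBase_countable (l : V) {v : Set Ordinal.{u}} (hv : v.Countable) :
    (ordinalBase l v).Countable := by
  refine Set.Countable.insert _ (Set.Countable.mono ?_
    ((hv.image Ordinal.toZFSet).preimage_of_injOn (Subtype.val_injective (p := (· ∈ V))).injOn))
  rintro x ⟨α, hα, hx⟩
  exact ⟨α, hα, hx.symm⟩

theorem OpClosure.exists_countable_ordinalBase {l : V} {v : Set Ordinal.{u}} {x : V}
    (hx : OpClosure (skolemOp V) (ordinalBase l v) x) :
    ∃ v' ⊆ v, v'.Countable ∧ OpClosure (skolemOp V) (ordinalBase l v') x := by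
  obtain ⟨s, hs, hsc, hx⟩ := hx.exists_countable
  refine ⟨{α ∈ v | ∃ y ∈ s, (y : ZFSet.{u}) = α.toZFSet}, fun α h => h.1, ?_, hx.mono ?_⟩
  · refine ((hsc.image Subtype.val).preimage Ordinal.toZFSet_injective).mono ?_
    rintro α ⟨-, y, hy, h⟩
    exact ⟨y, hy, h⟩
  · intro y hy
    rcases hs hy with rfl | ⟨α, hα, h⟩
    · exact Set.mem_insert _ _
    · exact Set.mem_insert_of_mem _ ⟨α, ⟨hα, y, hy, h⟩, h⟩

end Hull

theorem exists_triple_of_isMagidor {lam : Cardinal.{u}} (hcof : lam.ord.cof = Cardinal.aleph0)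
    (hsing : lam.ord.cof < lam) (hmag : IsMagidor lam) {γ : Ordinal.{u}} (hγ : lam.ord < γ) :
    ∃ (M : ZFSet.{u}) (Mseq : ℕ → setTheory.ElementarySubstructure M)
      (j : M ↪ₑ[setTheory] (ZFSet.vonNeumann γ)), IsMagidorTriple lam γ M Mseq j := by
  classical
  have hω : Cardinal.aleph0 < lam := hcof.symm.trans_lt hsing
  have hpos : 0 < lam.ord := by simpa using (Cardinal.aleph0_pos.trans hω)
  obtain ⟨G, hG⟩ := exists_universal_coloring Ordinal.{u}
  obtain ⟨μ, hμmono, -, hμlam, hμc⟩ := exists_seq_cardinal_cofinal hcof hsing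
  let V := ZFSet.vonNeumann γ
  let l : V := ⟨lam.ord.toZFSet, toZFSet_mem_vonNeumann.2 hγ⟩
  let Hull : Set Ordinal.{u} → Set V := fun v => {x | OpClosure (skolemOp V) (ordinalBase l v) x}
  have hHull : ∀ {v v'}, v ⊆ v' → Hull v ⊆ Hull v' := fun h x hx =>
    OpClosure.mono (ordinalBase_mono l h) hx
  have hex : ∀ v : Set Ordinal.{u}, ∃ e : Set ℕ → V, v.Countable → ∀ x ∈ Hull v, ∃ r, e r = x := by
    intro v
    by_cases hv : v.Countable
    · obtain ⟨e, he⟩ := exists_surjOn_opClosure (op := skolemOp V) (ordinalBase_countable l hv)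
        ⟨l, Set.mem_insert _ _⟩
      exact ⟨e, fun _ => he⟩
    · exact ⟨fun _ => l, fun h => (hv h).elim⟩
  choose e he using hex
  -- The initial part of the set supplies a real via `G`, and the rest supplies the hull in which
  -- that real is an index. The default 0 is never used for the colors that matter.
  obtain ⟨A, hAl, hAc, ⟨η, hη⟩, hAη⟩ := hmag fun w =>
    if h : ∃ α < lam.ord, (e (w.1 \ initialPart w.1) (G (initialPart w.1)) : ZFSet.{u}) =
      α.toZFSet then ⟨h.choose, h.choose_spec.1⟩ else ⟨0, hpos⟩
  have hAinf : A.Infinite := by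
    rw [← Set.infinite_coe_iff, Cardinal.infinite_iff, hAc]
    simpa using hω.le
  have hA'c := mk_diff_initialPart hω hAc
  have hA'ne : (A \ initialPart A).Nonempty := by
    rw [← Set.nonempty_coe_sort, ← Cardinal.mk_ne_zero_iff]
    exact (lt_of_lt_of_le (by simpa using Cardinal.aleph0_pos.trans hω) hA'c).ne'
  obtain ⟨a₀, ha₀⟩ := hA'ne
  -- Cutting at `μ n` keeps `w ∪ v` bounded in λ, as the coloring requires; the union still contains
  -- all of `A \ initialPart A`.
  let B : ℕ → Set Ordinal.{u} := fun n => (A \ initialPart A) ∩ Set.Iio (μ n).ord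
  have hBmono : Monotone B := fun m n hmn => Set.inter_subset_inter_right _
    (Set.Iio_subset_Iio (Cardinal.ord_le_ord.2 (hμmono.monotone hmn)))
  refine exists_magidorTriple hγ (N := fun n => Hull (B n))
    (fun n => skolemClosed_opClosure ⟨l, Set.mem_insert _ _⟩) (fun m n hmn => hHull (hBmono hmn))
    ⟨0, .base (Set.mem_insert _ _)⟩ (hA'c.trans (Cardinal.mk_le_mk_of_subset fun α hα => ?_)) hη ?_
    fun n x hx h => range_mem_opClosure hx h
  · have hαl : α < lam.ord := hAl hα.1
    obtain ⟨n, hn⟩ := hμc (Order.succ α.card)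
      ((isSingular_of_cof_lt hcof hsing).isSuccLimit.succ_lt (Cardinal.lt_ord.1 hαl))
    exact ⟨hαl, n, ⟨α.toZFSet, toZFSet_mem_vonNeumann.2 (hαl.trans hγ)⟩,
      .base (Set.mem_insert_of_mem _
        ⟨α, ⟨hα, Cardinal.lt_ord.2 (Order.succ_le_iff.1 hn)⟩, rfl⟩), rfl⟩
  · rintro n x hx hxη
    obtain ⟨v, hvB, hvc, hxv⟩ := OpClosure.exists_countable_ordinalBase hx
    obtain ⟨r, hr⟩ := he v hvc x hxv
    obtain ⟨w, hw, hwi, hwc, rfl⟩ := hG _ (initialPart_infinite hAinf) r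
    have hvA : v ⊆ A \ initialPart A := fun α hα => (hvB hα).1
    have hcount : Countable ↥(w ∪ v) := (hwc.union hvc).to_subtype
    have hinf : Infinite ↥(w ∪ v) := (hwi.mono Set.subset_union_left).to_subtype
    have hu : w ∪ v ∈ boundedCountable lam := by
      -- All of `initialPart A` lies below `a₀`, so `a₀` bounds `w`, while `μ n` bounds `v`.
      refine ⟨Cardinal.mk_eq_aleph0 _, max a₀ (μ n).ord,
        max_lt (hAl ha₀.1) (Cardinal.ord_lt_ord.2 (hμlam n)), ?_⟩
      rintro α (hα | hα)
      · exact lt_max_of_lt_left (lt_of_mem_initialPart (hw hα) ha₀)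
      · exact lt_max_of_lt_right (Set.mem_Iio.1 (hvB hα).2)
    have hinit : initialPart (w ∪ v) = w := initialPart_union hw hwi hvA
    have hrest : (w ∪ v) \ initialPart (w ∪ v) = v := by
      rw [hinit, Set.union_sdiff_left, sdiff_eq_left]
      exact Set.disjoint_left.2 fun α hα hα' => (hvA hα).2 (hw hα')
    refine hAη ⟨w ∪ v, hu⟩ (Set.union_subset (fun α hα => (hw hα).1) fun α hα => (hvA hα).1) ?_
    have hval : ∀ α, (e ((w ∪ v) \ initialPart (w ∪ v)) (G (initialPart (w ∪ v))) : ZFSet.{u}) =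
        α.toZFSet ↔ α = η := by
      intro α
      rw [hrest, hinit, hr, hxη]
      exact ⟨fun h => (Ordinal.toZFSet_injective h).symm, fun h => h ▸ rfl⟩
    have hexη : ∃ α < lam.ord, (e ((w ∪ v) \ initialPart (w ∪ v)) (G (initialPart (w ∪ v))) :
        ZFSet.{u}) = α.toZFSet := ⟨η, hη, (hval η).2 rfl⟩
    rw [dif_pos hexη]
    exact Subtype.ext ((hval _).1 hexη.choose_spec.2)

theorem theorem2p2 (lam : Cardinal.{u}) (hcof : lam.ord.cof = Cardinal.aleph0)
    (hsing : lam.ord.cof < lam) :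
    List.TFAE [
      IsMagidor lam,
      ∀ γ : Ordinal.{u}, lam.ord < γ →
        ∃ (M : ZFSet.{u}) (Mseq : ℕ → setTheory.ElementarySubstructure M)
          (j : M ↪ₑ[setTheory] (ZFSet.vonNeumann γ)), IsMagidorTriple lam γ M Mseq j,
      ∃ γ : Ordinal.{u}, lam.ord < γ ∧
        ∃ (M : ZFSet.{u}) (Mseq : ℕ → setTheory.ElementarySubstructure M)
          (j : M ↪ₑ[setTheory] (ZFSet.vonNeumann γ)), IsMagidorTriple lam γ M Mseq j] := by
  tfae_have 1 → 2 := fun h γ hγ => exists_triple_of_isMagidor hcof hsing h hγ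
  tfae_have 2 → 3 := fun h => ⟨Order.succ lam.ord, Order.lt_succ _, h _ (Order.lt_succ _)⟩
  tfae_have 3 → 1 := fun ⟨_, hγ, _, _, _, h⟩ => isMagidor_of_triple hcof hsing hγ h
  tfae_finish
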